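/- For $s>0$ let $B_s\subset\mathbb{R}^n$ be the open ball of radius $s$ centered at the origin. For every $n$ there exists a constant $C=C(n)>0$, depending only on $n$, such that the following holds for every $r>0$. Let $u: B_{\sqrt{2n+1}\,r}\times[0,r^2]\to\mathbb{R}$ be a smooth function whose graph flows by mean curvature, i.e. $$u_t=(1+|du|^2)^{1/2}\,\mathrm{div}\left(\frac{du}{(1+|du|^2)^{1/2}}\right)\quad\text{on } B_{\sqrt{2n+1}\,r}\times[0,r^2],$$ where $du$ and $\mathrm{div}$ are the gradient and the divergence in $\mathbb{R}^n$ (and $u_t$ is one-sided at $t=0$ and $t=r^2$). Then the area of the graph of $u(\cdot,r^2)$ over $B_{r/2}$ satisfies $$\int_{B_{r/2}}(1+|du|^2)^{1/2}(x,r^2)\,dx\le C\,r^n\left(1+r^{-1}\|u(\cdot,0)\|_\infty\right)^2,$$ where $\|u(\cdot,0)\|_\infty=\sup_{B_{\sqrt{2n+1}\,r}}|u(\cdot,0)|$ (the bound being void if this supremum is infinite). -/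

import Mathlib

open scoped ContDiff

noncomputable section

/-- The volume element `v = (1 + |dw|²)^{1/2}` of the graph of `w : ℝⁿ → ℝ`. -/
def volumeElement {n : ℕ} (w : EuclideanSpace ℝ (Fin n) → ℝ) (x : EuclideanSpace ℝ (Fin n)) : ℝ :=
  √(1 + ‖gradient w x‖ ^ 2)

/-- The Euclidean divergence `∑ᵢ ∂ᵢ Fᵢ` of a vector field `F` on `ℝⁿ`. -/
def divergence {n : ℕ} (F : EuclideanSpace ℝ (Fin n) → EuclideanSpace ℝ (Fin n))
    (x : EuclideanSpace ℝ (Fin n)) : ℝ :=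
  ∑ i : Fin n, (fderiv ℝ F x (EuclideanSpace.single i 1)) i

/-- The graph of `u : B_ρ × [0, T] → ℝ` flows by mean curvature, where `B_ρ` is the open ball of
radius `ρ` in `ℝⁿ` centered at the origin: `u` is smooth on `B_ρ × [0, T]` (up to the initial and
final times) and satisfies `u_t = (1 + |du|²)^{1/2} div (du / (1 + |du|²)^{1/2})` there. At `t = 0`
and `t = T` the time derivative is one-sided. The values of `u` outside `B_ρ × [0, T]` play no
role. -/
structure GraphFlowsByMeanCurvature {n : ℕ} (u : EuclideanSpace ℝ (Fin n) → ℝ → ℝ)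
    (ρ T : ℝ) : Prop where
  smooth : ContDiffOn ℝ ∞ (fun p : EuclideanSpace ℝ (Fin n) × ℝ => u p.1 p.2)
    (Metric.ball 0 ρ ×ˢ Set.Icc 0 T)
  flow : ∀ x ∈ Metric.ball (0 : EuclideanSpace ℝ (Fin n)) ρ, ∀ t ∈ Set.Icc 0 T,
    derivWithin (fun s => u x s) (Set.Icc 0 T) t =
      volumeElement (fun y => u y t) x *
        divergence (fun y => (volumeElement (fun z => u z t) y)⁻¹ • gradient (fun z => u z t) y) x

/-- The `n`-dimensional area `∫_Ω (1 + |dw|²)^{1/2} dx` of the graph of `w` over `Ω ⊆ ℝⁿ`. -/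
def graphArea {n : ℕ} (w : EuclideanSpace ℝ (Fin n) → ℝ) (Ω : Set (EuclideanSpace ℝ (Fin n))) :
    ENNReal :=
  ∫⁻ x in Ω, ENNReal.ofReal (volumeElement w x)

/-- The sup norm of `w` over `Ω`, possibly infinite. -/
def supNorm {n : ℕ} (w : EuclideanSpace ℝ (Fin n) → ℝ) (Ω : Set (EuclideanSpace ℝ (Fin n))) :
    ENNReal :=
  ⨆ x ∈ Ω, ENNReal.ofReal |w x|

end

/-! A sphere shrinking by mean curvature cannot be touched by the graph, so the initial bound
`|u| ≤ M` on `B_R` gives `|u| ≤ M + ρ` wherever `|x|² + 2nt < ρ²`, for every `ρ < R`. Take the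
weight `φ = η³` with `η = (ρ² - |x|² - 2nt)₊`. Along the flow `d/dt ∫ φ v ≤ -∫ φ H² v`. On the
other hand, integrating `div (φ u N)` for `N = du / v` and applying Cauchy–Schwarz gives
`∫ φ v ≤ K + (D ∫ φ H² v)^{1/2}`. Together these are a Riccati inequality for `∫ φ v`, which bounds
the area at positive times independently of the initial area. The bound reaches the final time by
Fatou's lemma, which avoids any uniform control of `du` up to `t = T`.
-/

open Filter MeasureTheory Set Topology

local notation:max "ℝ^" n:max => EuclideanSpace ℝ (Fin n)

section SecondOrder

variable {E : Type*} [NormedAddCommGroup E] [InnerProductSpace ℝ E]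

theorem inner_apply_self_le_trace [FiniteDimensional ℝ E] {A : E →ₗ[ℝ] E}
    (hA : ∀ h, 0 ≤ inner ℝ (A h) h) {p : E} (hp : ‖p‖ ≤ 1) :
    inner ℝ (A p) p ≤ LinearMap.trace ℝ E A := by
  have diag_nonneg (h : E) : 0 ≤ inner ℝ h (A h) := real_inner_comm h (A h) ▸ hA h
  rcases eq_or_ne p 0 with rfl | hp0
  · rw [inner_zero_right, A.trace_eq_sum_inner (stdOrthonormalBasis ℝ E)]
    exact Finset.sum_nonneg fun i _ => diag_nonneg _
  have he : ‖‖p‖⁻¹ • p‖ = 1 := norm_smul_inv_norm (𝕜 := ℝ) hp0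
  set e := ‖p‖⁻¹ • p
  obtain ⟨s, b, hes, hb⟩ := Orthonormal.exists_orthonormalBasis_extension (𝕜 := ℝ) (v := {e})
    ⟨fun i => by rwa [i.2], fun i j hij => absurd (Subsingleton.elim i j) hij⟩
  have hpe : p = ‖p‖ • e := (smul_inv_smul₀ (norm_ne_zero_iff.2 hp0) p).symm
  calc inner ℝ (A p) p = ‖p‖ ^ 2 * inner ℝ (A e) e := by
        rw [hpe, map_smul, real_inner_smul_left, real_inner_smul_right, ← hpe]; ring
    _ ≤ inner ℝ (A e) e := mul_le_of_le_one_left (hA e) (pow_le_one₀ (norm_nonneg p) hp)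
    _ = inner ℝ (b ⟨e, hes rfl⟩) (A (b ⟨e, hes rfl⟩)) := by rw [hb, real_inner_comm]
    _ ≤ ∑ i, inner ℝ (b i) (A (b i)) :=
        Finset.single_le_sum (fun i _ => diag_nonneg _) (Finset.mem_univ _)
    _ = LinearMap.trace ℝ E A := (A.trace_eq_sum_inner b).symm

variable [CompleteSpace E] {f : E → ℝ} {x : E}

theorem contDiffAt_gradient {m k : ℕ∞ω} (hf : ContDiffAt ℝ m f x) (hk : k + 1 ≤ m) :
    ContDiffAt ℝ k (gradient f) x :=
  (InnerProductSpace.toDual ℝ E).symm.contDiff.contDiffAt.comp x (hf.fderiv_right hk)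

theorem differentiableAt_gradient (hf : ContDiffAt ℝ 2 f x) :
    DifferentiableAt ℝ (gradient f) x :=
  (contDiffAt_gradient hf (k := 1) (by norm_num)).differentiableAt one_ne_zero

theorem inner_fderiv_gradient (hf : ContDiffAt ℝ 2 f x) (h k : E) :
    inner ℝ (fderiv ℝ (gradient f) x h) k = fderiv ℝ (fderiv ℝ f) x h k := by
  have hf' : DifferentiableAt ℝ (fderiv ℝ f) x :=
    (hf.fderiv_right (m := 1) (by norm_num)).differentiableAt one_ne_zero
  have hgrad : HasFDerivAt (gradient f) _ x :=
    (InnerProductSpace.toDual ℝ E).symm.toContinuousLinearEquiv.hasFDerivAt.comp x hf'.hasFDerivAt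
  rw [hgrad.fderiv]
  exact InnerProductSpace.toDual_symm_apply

theorem inner_fderiv_gradient_comm (hf : ContDiffAt ℝ 2 f x) (h k : E) :
    inner ℝ (fderiv ℝ (gradient f) x h) k = inner ℝ (fderiv ℝ (gradient f) x k) h := by
  rw [inner_fderiv_gradient hf, inner_fderiv_gradient hf]
  exact hf.isSymmSndFDerivAt (by simp) h k

theorem second_deriv_nonneg_of_isLocalMin {g g' : ℝ → ℝ} {a c : ℝ} (hg : IsLocalMin g a)
    (hd : ∀ᶠ s in 𝓝 a, HasDerivAt g (g' s) s) (hd' : HasDerivAt g' c a) : 0 ≤ c := by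
  by_contra! hc
  have hderiv : deriv g =ᶠ[𝓝 a] g' := hd.mono fun s hs => hs.deriv
  have hderiv2 : deriv (deriv g) a = c := hderiv.deriv_eq.trans hd'.deriv
  have hmax : IsLocalMax g a := isLocalMax_of_deriv_deriv_neg (hderiv2 ▸ hc) hg.deriv_eq_zero
    hd.self_of_nhds.continuousAt
  have hconst : g =ᶠ[𝓝 a] fun _ => g a := by
    filter_upwards [hg, hmax] with s h1 h2 using le_antisymm h2 h1
  have hzero : deriv g =ᶠ[𝓝 a] fun _ => 0 := by
    filter_upwards [hconst.eventuallyEq_nhds] with s hs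
    rw [hs.deriv_eq, deriv_const]
  rw [hzero.deriv_eq, deriv_const] at hderiv2
  exact hc.ne' hderiv2

theorem inner_fderiv_gradient_nonneg_of_isLocalMin (hf : ContDiffAt ℝ 2 f x)
    (hmin : IsLocalMin f x) (h : E) : 0 ≤ inner ℝ (fderiv ℝ (gradient f) x h) h := by
  have hline (s : ℝ) : HasDerivAt (fun s : ℝ => x + s • h) h s := by
    simpa using ((hasDerivAt_id s).smul_const h).const_add x
  have hcont : Tendsto (fun s : ℝ => x + s • h) (𝓝 0) (𝓝 x) := by
    simpa using (hline 0).continuousAt.tendsto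
  have hfst : ∀ᶠ s : ℝ in 𝓝 0, HasDerivAt (fun s : ℝ => f (x + s • h))
      (inner ℝ (gradient f (x + s • h)) h) s := by
    filter_upwards [hcont.eventually (hf.eventually (by norm_num))] with s hs
    rw [inner_gradient_left]
    exact (hs.differentiableAt two_ne_zero).hasFDerivAt.comp_hasDerivAt s (hline s)
  have hsnd : HasDerivAt (fun s : ℝ => gradient f (x + s • h)) (fderiv ℝ (gradient f) x h) 0 := by
    have hgrad : HasFDerivAt (gradient f) (fderiv ℝ (gradient f) x) (x + (0 : ℝ) • h) := by
      simpa using (differentiableAt_gradient hf).hasFDerivAt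
    exact hgrad.comp_hasDerivAt (0 : ℝ) (hline 0)
  have hmin' : IsLocalMin (fun s : ℝ => f (x + s • h)) 0 := by
    simpa [IsLocalMin, IsMinFilter] using hcont.eventually hmin
  refine second_deriv_nonneg_of_isLocalMin hmin' hfst ?_
  simpa using hsnd.inner ℝ (hasDerivAt_const 0 h)

end SecondOrder

section Divergence

variable {n : ℕ}

variable {F G : ℝ^n → ℝ^n} {x : ℝ^n}

theorem divergence_eq_trace (F : ℝ^n → ℝ^n) (x : ℝ^n) :
    divergence F x = LinearMap.trace ℝ ℝ^n (fderiv ℝ F x) := by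
  rw [LinearMap.trace_eq_sum_inner _ (EuclideanSpace.basisFun (Fin n) ℝ)]
  simp [divergence, EuclideanSpace.inner_single_left]

theorem divergence_smul {g : ℝ^n → ℝ} (hg : DifferentiableAt ℝ g x) (hF : DifferentiableAt ℝ F x) :
    divergence (fun y => g y • F y) x = g x * divergence F x + fderiv ℝ g x (F x) := by
  have hrank : LinearMap.trace ℝ ℝ^n ((fderiv ℝ g x).smulRight (F x) : ℝ^n →L[ℝ] ℝ^n) =
      fderiv ℝ g x (F x) := LinearMap.trace_smulRight (fderiv ℝ g x : ℝ^n →ₗ[ℝ] ℝ) (F x)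
  simp only [divergence_eq_trace, fderiv_fun_smul hg hF, ContinuousLinearMap.toLinearMap_add,
    ContinuousLinearMap.toLinearMap_smul, map_add, map_smul, smul_eq_mul, hrank]

theorem divergence_sub (hF : DifferentiableAt ℝ F x) (hG : DifferentiableAt ℝ G x) :
    divergence (fun y => F y - G y) x = divergence F x - divergence G x := by
  simp only [divergence_eq_trace, fderiv_fun_sub hF hG, ContinuousLinearMap.toLinearMap_sub,
    map_sub]

theorem divergence_id (x : ℝ^n) : divergence (fun y => y) x = n := by
  simp [divergence]

theorem continuous_divergence (hF : ContDiff ℝ 1 F) : Continuous (divergence F) := by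
  have := hF.continuous_fderiv one_ne_zero
  unfold divergence
  fun_prop

theorem integral_divergence_eq_zero (hF : ContDiff ℝ 1 F) (hc : HasCompactSupport F) :
    Integrable (divergence F) ∧ ∫ x, divergence F x = 0 := by
  have hFi (i : Fin n) : ContDiff ℝ 1 (F · i) := (EuclideanSpace.proj (𝕜 := ℝ) i).contDiff.comp hF
  have hci (i : Fin n) : HasCompactSupport (F · i) :=
    hc.comp_left (g := fun y : ℝ^n => y i) rfl
  have hdiv : divergence F = fun x => ∑ i, fderiv ℝ (F · i) x (EuclideanSpace.single i 1) := by
    ext x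
    refine Finset.sum_congr rfl fun i _ => ?_
    have h : HasFDerivAt (F · i) _ x := (EuclideanSpace.proj (𝕜 := ℝ) i).hasFDerivAt.comp x
      (hF.differentiable one_ne_zero x).hasFDerivAt
    rw [h.fderiv]
    rfl
  have hint (i : Fin n) :
      Integrable (fun x => fderiv ℝ (F · i) x (EuclideanSpace.single i 1)) :=
    (((hFi i).continuous_fderiv one_ne_zero).clm_apply
      continuous_const).integrable_of_hasCompactSupport ((hci i).fderiv_apply ℝ _)
  rw [hdiv, integral_finsetSum _ fun i _ => hint i]
  refine ⟨integrable_finsetSum _ fun i _ => hint i, Finset.sum_eq_zero fun i _ => ?_⟩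
  simpa using integral_mul_fderiv_eq_neg_fderiv_mul_of_integrable (μ := volume) (𝕜 := ℝ)
    (f := fun _ : ℝ^n => (1 : ℝ)) (g := (F · i)) (v := EuclideanSpace.single i 1)
    (by simp) (by simpa only [one_mul] using hint i)
    (by simpa using (hFi i).continuous.integrable_of_hasCompactSupport (hci i))
    (by fun_prop) (fun x _ => (hFi i).differentiable one_ne_zero x)

end Divergence

section Graph

variable {n : ℕ}

theorem volumeElement_pos (w : ℝ^n → ℝ) (x : ℝ^n) : 0 < volumeElement w x := by
  unfold volumeElement
  positivity

theorem volumeElement_sq (w : ℝ^n → ℝ) (x : ℝ^n) :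
    volumeElement w x ^ 2 = 1 + ‖gradient w x‖ ^ 2 :=
  Real.sq_sqrt (by positivity)

/-- The vector `N = dw / v`, which is minus the horizontal part of the upward unit normal
`(-dw, 1) / v` of the graph of `w`. -/
noncomputable def conormal (w : ℝ^n → ℝ) (x : ℝ^n) : ℝ^n :=
  (volumeElement w x)⁻¹ • gradient w x

/-- The mean curvature `H = div (dw / v)` of the graph of `w`, with respect to the upward normal. -/
noncomputable def meanCurvature (w : ℝ^n → ℝ) (x : ℝ^n) : ℝ :=
  divergence (conormal w) x

theorem volumeElement_smul_conormal (w : ℝ^n → ℝ) (x : ℝ^n) :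
    volumeElement w x • conormal w x = gradient w x :=
  smul_inv_smul₀ (volumeElement_pos w x).ne' _

theorem inner_gradient_eq_mul_inner_conormal (w : ℝ^n → ℝ) (x y : ℝ^n) :
    inner ℝ (gradient w x) y = volumeElement w x * inner ℝ (conormal w x) y := by
  rw [← volumeElement_smul_conormal, real_inner_smul_left]

theorem norm_conormal_sq (w : ℝ^n → ℝ) (x : ℝ^n) :
    ‖conormal w x‖ ^ 2 = 1 - (volumeElement w x ^ 2)⁻¹ := by
  have hv := volumeElement_pos w x
  have hsq := volumeElement_sq w x
  rw [← volumeElement_smul_conormal, norm_smul, Real.norm_of_nonneg hv.le] at hsq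
  field_simp
  linarith

theorem norm_conormal_le_one (w : ℝ^n → ℝ) (x : ℝ^n) : ‖conormal w x‖ ≤ 1 := by
  have := norm_conormal_sq w x
  have : 0 ≤ (volumeElement w x ^ 2)⁻¹ := by positivity
  exact (sq_le_one_iff₀ (norm_nonneg _)).1 (by linarith)

theorem inner_conormal_sq_le_norm_sq (w : ℝ^n → ℝ) (x y : ℝ^n) :
    inner ℝ (conormal w x) y ^ 2 ≤ ‖y‖ ^ 2 :=
  sq_le_sq.2 <| by
    rw [abs_norm]
    exact (abs_real_inner_le_norm _ _).trans
      (mul_le_of_le_one_left (norm_nonneg y) (norm_conormal_le_one w x))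

variable {w : ℝ^n → ℝ} {x : ℝ^n}

theorem contDiffAt_volumeElement {m k : ℕ∞ω} (hw : ContDiffAt ℝ m w x) (hk : k + 1 ≤ m) :
    ContDiffAt ℝ k (volumeElement w) x :=
  (contDiffAt_const.add ((contDiffAt_gradient hw hk).norm_sq ℝ)).sqrt (by positivity)

theorem contDiffAt_conormal {m k : ℕ∞ω} (hw : ContDiffAt ℝ m w x) (hk : k + 1 ≤ m) :
    ContDiffAt ℝ k (conormal w) x :=
  ((contDiffAt_volumeElement hw hk).inv (volumeElement_pos w x).ne').smul
    (contDiffAt_gradient hw hk)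

theorem contDiff_conormal (hw : ContDiff ℝ 2 w) : ContDiff ℝ 1 (conormal w) :=
  contDiff_iff_contDiffAt.2 fun _ => contDiffAt_conormal hw.contDiffAt (by norm_num)

theorem continuous_meanCurvature (hw : ContDiff ℝ 2 w) : Continuous (meanCurvature w) :=
  continuous_divergence (contDiff_conormal hw)

theorem differentiableAt_volumeElement (hw : ContDiffAt ℝ 2 w x) :
    DifferentiableAt ℝ (volumeElement w) x :=
  (contDiffAt_volumeElement hw (k := 1) (by norm_num)).differentiableAt one_ne_zero

theorem differentiableAt_conormal (hw : ContDiffAt ℝ 2 w x) :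
    DifferentiableAt ℝ (conormal w) x :=
  (contDiffAt_conormal hw (k := 1) (by norm_num)).differentiableAt one_ne_zero

theorem fderiv_volumeElement (hw : ContDiffAt ℝ 2 w x) (h : ℝ^n) :
    fderiv ℝ (volumeElement w) x h =
      inner ℝ (conormal w x) (fderiv ℝ (gradient w) x h) := by
  have hv : HasFDerivAt (volumeElement w) _ x :=
    ((differentiableAt_gradient hw).hasFDerivAt.norm_sq.const_add 1).sqrt (by positivity)
  rw [hv.fderiv]
  simp only [one_div, mul_inv_rev, smul_apply, ContinuousLinearMap.comp_apply,
    coe_innerSL_apply, inner_gradient_left, nsmul_eq_mul, Nat.cast_ofNat, smul_eq_mul, conormal,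
    volumeElement, real_inner_smul_left]
  field_simp

theorem volumeElement_mul_meanCurvature (hw : ContDiffAt ℝ 2 w x) :
    volumeElement w x * meanCurvature w x = divergence (gradient w) x -
      inner ℝ (fderiv ℝ (gradient w) x (conormal w x)) (conormal w x) := by
  have hgrad : gradient w = fun y => volumeElement w y • conormal w y :=
    funext fun y => (volumeElement_smul_conormal w y).symm
  have hdiv : divergence (gradient w) x = volumeElement w x * meanCurvature w x +
      fderiv ℝ (volumeElement w) x (conormal w x) := by
    conv_lhs => rw [hgrad]
    exact divergence_smul (differentiableAt_volumeElement hw) (differentiableAt_conormal hw)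
  rw [hdiv, fderiv_volumeElement hw, real_inner_comm, add_sub_cancel_right]

/-- The field `Y = v x - ⟨dw, x⟩ N`: `v` times the position vector, with its index raised by the
inverse of the metric of the graph of `w`. -/
noncomputable def positionField (w : ℝ^n → ℝ) (x : ℝ^n) : ℝ^n :=
  volumeElement w x • x - inner ℝ (gradient w x) x • conormal w x

theorem contDiff_positionField (hw : ContDiff ℝ 2 w) : ContDiff ℝ 1 (positionField w) := by
  refine contDiff_iff_contDiffAt.2 fun x => ?_
  have hk : (1 : ℕ∞ω) + 1 ≤ 2 := by norm_num
  exact ((contDiffAt_volumeElement hw.contDiffAt hk).smul contDiffAt_id).sub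
    (((contDiffAt_gradient hw.contDiffAt hk).inner ℝ contDiffAt_id).smul
      (contDiffAt_conormal hw.contDiffAt hk))

theorem divergence_positionField (hw : ContDiffAt ℝ 2 w x) :
    divergence (positionField w) x = volumeElement w x * (n - ‖conormal w x‖ ^ 2) -
      inner ℝ (gradient w x) x * meanCurvature w x := by
  have hv := differentiableAt_volumeElement hw
  have hN := differentiableAt_conormal hw
  have hgrad := differentiableAt_gradient hw
  have hid : DifferentiableAt ℝ (fun y : ℝ^n => y) x := differentiableAt_id
  have hinner : DifferentiableAt ℝ (fun y => inner ℝ (gradient w y) y) x := hgrad.inner ℝ hid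
  have hcomm : inner ℝ (conormal w x) (fderiv ℝ (gradient w) x x) =
      inner ℝ (fderiv ℝ (gradient w) x (conormal w x)) x := by
    rw [real_inner_comm, inner_fderiv_gradient_comm hw]
  calc divergence (positionField w) x
    _ = (volumeElement w x * n + inner ℝ (conormal w x) (fderiv ℝ (gradient w) x x)) -
        (inner ℝ (gradient w x) x * meanCurvature w x +
          (inner ℝ (gradient w x) (conormal w x) +
            inner ℝ (fderiv ℝ (gradient w) x (conormal w x)) x)) := by
      unfold positionField meanCurvature
      rw [divergence_sub (hv.fun_smul hid) (hinner.fun_smul hN), divergence_smul hv hid,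
        divergence_smul hinner hN, divergence_id, fderiv_volumeElement hw,
        fderiv_inner_apply ℝ hgrad hid, fderiv_fun_id, ContinuousLinearMap.id_apply]
    _ = _ := by
      rw [hcomm, inner_gradient_eq_mul_inner_conormal w x (conormal w x),
        real_inner_self_eq_norm_sq]
      ring

theorem inner_positionField_nonneg (w : ℝ^n → ℝ) (x : ℝ^n) :
    0 ≤ inner ℝ x (positionField w x) := by
  have h : inner ℝ x (positionField w x) =
      volumeElement w x * (‖x‖ ^ 2 - inner ℝ (conormal w x) x ^ 2) := by
    rw [positionField, inner_sub_right, real_inner_smul_right, real_inner_smul_right,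
      inner_gradient_eq_mul_inner_conormal, real_inner_self_eq_norm_sq, real_inner_comm x]
    ring
  rw [h]
  exact mul_nonneg (volumeElement_pos w x).le
    (sub_nonneg.2 (inner_conormal_sq_le_norm_sq w x x))

end Graph

section Barrier

variable {n : ℕ} {w : ℝ^n → ℝ} {x : ℝ^n}

theorem fderiv_gradient_norm_sq_add_sub_sq (hw : ContDiffAt ℝ 2 w x) (c : ℝ) :
    fderiv ℝ (gradient fun y => ‖y‖ ^ 2 + (w y - c) ^ 2) x =
      (2 : ℝ) • (ContinuousLinearMap.id ℝ ℝ^n + (w x - c) • fderiv ℝ (gradient w) x +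
        (innerSL ℝ (gradient w x)).smulRight (gradient w x)) := by
  have hgrad : gradient (fun y => ‖y‖ ^ 2 + (w y - c) ^ 2) =ᶠ[𝓝 x]
      fun y => (2 : ℝ) • (y + (w y - c) • gradient w y) := by
    filter_upwards [hw.eventually (by norm_num)] with y hy
    have hwy : HasFDerivAt w (fderiv ℝ w y) y := (hy.differentiableAt two_ne_zero).hasFDerivAt
    refine HasGradientAt.gradient (hasGradientAt_iff_hasFDerivAt.2 ?_)
    refine ((hasFDerivAt_id y).norm_sq.add ((hwy.sub_const c).pow 2)).congr_fderiv ?_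
    ext h
    simp only [id_eq, ContinuousLinearMap.comp_id, Nat.add_one_sub_one, pow_one, nsmul_eq_mul,
      Nat.cast_ofNat, add_apply, smul_apply, coe_innerSL_apply, smul_eq_mul, smul_add, map_add,
      map_smul, toDual_gradient, InnerProductSpace.toDual_apply_apply, add_right_inj]
    ring
  have hwx : HasFDerivAt w (fderiv ℝ w x) x := (hw.differentiableAt two_ne_zero).hasFDerivAt
  rw [hgrad.fderiv_eq]
  refine (((hasFDerivAt_id x).add ((hwx.sub_const c).smul
    (differentiableAt_gradient hw).hasFDerivAt)).const_smul (2 : ℝ)).fderiv.trans ?_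
  congr 1
  ext h : 1
  simp [add_assoc]

theorem add_mul_meanCurvature_nonneg_of_isLocalMin (hw : ContDiffAt ℝ 2 w x) {c : ℝ}
    (hmin : IsLocalMin (fun y => ‖y‖ ^ 2 + (w y - c) ^ 2) x) :
    0 ≤ n + (w x - c) * (volumeElement w x * meanCurvature w x) := by
  have hf : ContDiffAt ℝ 2 (fun y => ‖y‖ ^ 2 + (w y - c) ^ 2) x := by
    have : ContDiffAt ℝ 2 (fun y : ℝ^n => ‖y‖ ^ 2) x := contDiffAt_id.norm_sq ℝ
    fun_prop
  -- The trace minus the second derivative along `N` turns the Laplacian of `w` into `v H`.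
  have htrace := inner_apply_self_le_trace
    (A := (fderiv ℝ (gradient fun y => ‖y‖ ^ 2 + (w y - c) ^ 2) x : ℝ^n →ₗ[ℝ] ℝ^n))
    (inner_fderiv_gradient_nonneg_of_isLocalMin hf hmin) (norm_conormal_le_one w x)
  have hrank : LinearMap.trace ℝ ℝ^n
      ((innerSL ℝ (gradient w x)).smulRight (gradient w x) : ℝ^n →L[ℝ] ℝ^n) =
        volumeElement w x ^ 2 - 1 := by
    rw [volumeElement_sq, add_sub_cancel_left, ← real_inner_self_eq_norm_sq]
    exact LinearMap.trace_smulRight (innerSL ℝ (gradient w x) : ℝ^n →ₗ[ℝ] ℝ) (gradient w x)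
  have hid : LinearMap.trace ℝ ℝ^n (ContinuousLinearMap.id ℝ ℝ^n) = n :=
    (LinearMap.trace_id ℝ ℝ^n).trans (by simp)
  have hN : inner ℝ (conormal w x) (conormal w x) + inner ℝ (gradient w x) (conormal w x) *
      inner ℝ (gradient w x) (conormal w x) = volumeElement w x ^ 2 - 1 := by
    have hv := volumeElement_pos w x
    rw [inner_gradient_eq_mul_inner_conormal, real_inner_self_eq_norm_sq, norm_conormal_sq]
    field_simp
    ring
  rw [fderiv_gradient_norm_sq_add_sub_sq hw] at htrace
  simp only [ContinuousLinearMap.toLinearMap_smul, ContinuousLinearMap.toLinearMap_add, map_smul,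
    map_add, hrank, hid, ← divergence_eq_trace, smul_eq_mul, LinearMap.smul_apply,
    LinearMap.add_apply, ContinuousLinearMap.coe_coe, ContinuousLinearMap.id_apply,
    ContinuousLinearMap.smulRight_apply, innerSL_apply_apply, inner_add_left,
    real_inner_smul_left] at htrace
  rw [volumeElement_mul_meanCurvature hw]
  linarith

end Barrier

section MinimumPrinciple

theorem hasDerivWithinAt_Iic_nonpos_of_isLocalMinOn {g : ℝ → ℝ} {d a : ℝ}
    (hg : HasDerivWithinAt g d (Iic a) a) (hmin : IsLocalMinOn g (Iic a) a) : d ≤ 0 := by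
  have hcone : (a - 1) - a ∈ posTangentConeAt (Iic a) a :=
    sub_mem_posTangentConeAt_of_segment_subset
      ((convex_Iic a).segment_subset self_mem_Iic
        (sub_le_self a zero_le_one))
  simpa using hmin.hasFDerivWithinAt_nonneg hg.hasFDerivWithinAt hcone

variable {X : Type*} [TopologicalSpace X] {K : Set X} {F : X → ℝ → ℝ} {T m : ℝ}

theorem strict_parabolic_minimum_principle (hK : IsCompact K)
    (hF : ContinuousOn (Function.uncurry F) (K ×ˢ Icc 0 T)) (h0 : ∀ x ∈ K, m ≤ F x 0)
    (hside : ∀ x ∈ K \ interior K, ∀ t ∈ Icc 0 T, m ≤ F x t)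
    (hmin : ∀ x ∈ interior K, ∀ t ∈ Ioc 0 T, IsLocalMin (F · t) x →
      ∃ d > 0, HasDerivWithinAt (F x) d (Iic t) t)
    {x : X} (hx : x ∈ K) {t : ℝ} (ht : t ∈ Icc 0 T) : m ≤ F x t := by
  obtain ⟨⟨y, s⟩, ⟨hy, hs⟩, hys⟩ :=
    (hK.prod isCompact_Icc).exists_isMinOn ⟨(x, t), hx, ht⟩ hF
  simp only at hy hs
  have hle {z : X} (hz : z ∈ K) {r : ℝ} (hr : r ∈ Icc 0 T) : F y s ≤ F z r :=
    isMinOn_iff.1 hys (z, r) ⟨hz, hr⟩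
  refine le_trans ?_ (hle hx ht)
  rcases hs.1.eq_or_lt with rfl | hs0
  · exact h0 y hy
  by_cases hyi : y ∈ interior K
  swap
  · exact hside y ⟨hy, hyi⟩ s hs
  have hspace : IsLocalMin (F · s) y := by
    filter_upwards [mem_interior_iff_mem_nhds.1 hyi] with z hz using hle hz hs
  have htime : IsLocalMinOn (F y) (Iic s) s := by
    filter_upwards [Ioc_mem_nhdsLE hs0] with r hr using hle hy ⟨hr.1.le, hr.2.trans hs.2⟩
  obtain ⟨d, hd, hderiv⟩ := hmin y hyi s ⟨hs0, hs.2⟩ hspace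
  exact absurd (hasDerivWithinAt_Iic_nonpos_of_isLocalMinOn hderiv htime) hd.not_ge

theorem parabolic_minimum_principle (hK : IsCompact K)
    (hF : ContinuousOn (Function.uncurry F) (K ×ˢ Icc 0 T)) (h0 : ∀ x ∈ K, m ≤ F x 0)
    (hside : ∀ x ∈ K \ interior K, ∀ t ∈ Icc 0 T, m ≤ F x t)
    (hmin : ∀ x ∈ interior K, ∀ t ∈ Ioc 0 T, IsLocalMin (F · t) x →
      ∃ d ≥ 0, HasDerivWithinAt (F x) d (Iic t) t)
    {x : X} (hx : x ∈ K) {t : ℝ} (ht : t ∈ Icc 0 T) : m ≤ F x t := by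
  have hperturbed (ε : ℝ) (hε : 0 < ε) : m ≤ F x t + ε * t := by
    refine strict_parabolic_minimum_principle (F := fun y s => F y s + ε * s) hK ?_ ?_ ?_ ?_ hx ht
    · exact hF.add (by fun_prop)
    · simpa using h0
    · exact fun y hy s hs => (hside y hy s hs).trans
        (le_add_of_nonneg_right (mul_nonneg hε.le hs.1))
    · intro y hy s hs hloc
      obtain ⟨d, hd, hderiv⟩ := hmin y hy s hs (by simpa [IsLocalMin, IsMinFilter] using hloc)
      refine ⟨d + ε, by linarith, hderiv.add ?_⟩
      simpa using (hasDerivWithinAt_id s (Iic s)).const_mul ε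
  have hlim : Tendsto (fun ε => F x t + ε * t) (𝓝[>] 0) (𝓝 (F x t)) :=
    tendsto_nhdsWithin_of_tendsto_nhds
      ((by fun_prop : Continuous fun ε => F x t + ε * t).tendsto' 0 _ (by simp))
  exact ge_of_tendsto hlim (eventually_mem_nhdsWithin.mono hperturbed)

end MinimumPrinciple

namespace GraphFlowsByMeanCurvature

variable {n : ℕ} {u : ℝ^n → ℝ → ℝ} {ρ T : ℝ} {x : ℝ^n} {t : ℝ}

theorem contDiffAt (hu : GraphFlowsByMeanCurvature u ρ T) (hx : x ∈ Metric.ball 0 ρ)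
    (ht : t ∈ Ioo 0 T) : ContDiffAt ℝ ∞ (Function.uncurry u) (x, t) :=
  hu.smooth.contDiffAt (prod_mem_nhds (Metric.isOpen_ball.mem_nhds hx) (Icc_mem_nhds ht.1 ht.2))

theorem contDiffAt_slice (hu : GraphFlowsByMeanCurvature u ρ T) (hx : x ∈ Metric.ball 0 ρ)
    (ht : t ∈ Ioo 0 T) : ContDiffAt ℝ 2 (u · t) x :=
  ((hu.contDiffAt hx ht).of_le (WithTop.coe_le_coe.2 le_top)).comp (f := fun y => (y, t)) x
    (by fun_prop)

theorem hasDerivAt (hu : GraphFlowsByMeanCurvature u ρ T) (hx : x ∈ Metric.ball 0 ρ)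
    (ht : t ∈ Ioo 0 T) :
    HasDerivAt (u x) (volumeElement (u · t) x * meanCurvature (u · t) x) t := by
  have hdiff : ContDiffAt ℝ ∞ (u x) t :=
    (hu.contDiffAt hx ht).comp (f := fun s => (x, s)) t (by fun_prop)
  have hflow := hu.flow x hx t (Ioo_subset_Icc_self ht)
  rw [derivWithin_of_mem_nhds (Icc_mem_nhds ht.1 ht.2)] at hflow
  exact hflow ▸ (hdiff.differentiableAt (by simp)).hasDerivAt

theorem sphere_barrier (hu : GraphFlowsByMeanCurvature u ρ T) {R c : ℝ} (hR : 0 < R)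
    (hRρ : R < ρ) (h0 : ∀ y ∈ Metric.closedBall (0 : ℝ^n) R, R ≤ |u y 0 - c|)
    (hx : x ∈ Metric.closedBall 0 R) (ht : t ∈ Ico 0 T) :
    R ^ 2 ≤ ‖x‖ ^ 2 + (u x t - c) ^ 2 + 2 * n * t := by
  have hsub : Metric.closedBall (0 : ℝ^n) R ⊆ Metric.ball 0 ρ := Metric.closedBall_subset_ball hRρ
  refine parabolic_minimum_principle (F := fun y s => ‖y‖ ^ 2 + (u y s - c) ^ 2 + 2 * n * s)
    (isCompact_closedBall (0 : ℝ^n) R) ?_ ?_ ?_ ?_ hx (right_mem_Icc.2 ht.1)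
  · have := hu.smooth.continuousOn.mono (prod_mono hsub (Icc_subset_Icc_right ht.2.le))
    unfold Function.uncurry
    fun_prop
  · intro y hy
    have := sq_le_sq' (by linarith [abs_nonneg (u y 0 - c), h0 y hy]) (h0 y hy)
    rw [sq_abs] at this
    nlinarith [sq_nonneg ‖y‖]
  · rintro y ⟨-, hyint⟩ s hs
    rw [interior_closedBall _ hR.ne', Metric.mem_ball, dist_zero_right, not_lt] at hyint
    have : 0 ≤ 2 * n * s := mul_nonneg (by positivity) hs.1
    nlinarith [sq_nonneg (u y s - c)]
  · intro y hy s hs hmin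
    have hyρ : y ∈ Metric.ball 0 ρ := hsub (interior_subset hy)
    have hsT : s ∈ Ioo 0 T := ⟨hs.1, hs.2.trans_lt ht.2⟩
    have hcurv := add_mul_meanCurvature_nonneg_of_isLocalMin (hu.contDiffAt_slice hyρ hsT) (c := c)
      (by simpa [IsLocalMin, IsMinFilter] using hmin)
    refine ⟨2 * (n + (u y s - c) * (volumeElement (u · s) y * meanCurvature (u · s) y)),
      by positivity, HasDerivAt.hasDerivWithinAt ?_⟩
    refine (((((hu.hasDerivAt hyρ hsT).sub_const c).pow 2).const_add (‖y‖ ^ 2)).add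
      ((hasDerivAt_id s).const_mul (2 * n : ℝ))).congr_deriv ?_
    simp only [Nat.cast_ofNat, Nat.add_one_sub_one, pow_one, mul_one]
    ring

theorem abs_apply_le (hu : GraphFlowsByMeanCurvature u ρ T) {R M : ℝ} (hR : 0 < R) (hRρ : R < ρ)
    (h0 : ∀ y ∈ Metric.ball (0 : ℝ^n) ρ, |u y 0| ≤ M) (ht : t ∈ Ico 0 T)
    (hxt : ‖x‖ ^ 2 + 2 * n * t < R ^ 2) : |u x t| ≤ M + R := by
  have hxR : x ∈ Metric.closedBall 0 R := by
    have : 0 ≤ 2 * n * t := mul_nonneg (by positivity) ht.1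
    rw [mem_closedBall_zero_iff]
    exact (lt_of_pow_lt_pow_left₀ 2 hR.le (by linarith)).le
  have hsub : Metric.closedBall (0 : ℝ^n) R ⊆ Metric.ball 0 ρ := Metric.closedBall_subset_ball hRρ
  have hcont : ContinuousOn (fun s => |u x s|) (Icc 0 t) :=
    (hu.smooth.continuousOn.comp (f := fun s => (x, s)) (by fun_prop)
      fun s hs => ⟨hsub hxR, hs.1, hs.2.trans ht.2.le⟩).abs
  by_contra! hlt
  obtain ⟨s, hs, hus⟩ := intermediate_value_Icc ht.1 hcont
    (show M + R ∈ Icc |u x 0| |u x t| from ⟨by linarith [h0 x (hsub hxR)], hlt.le⟩)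
  -- At time `s` the graph would pass through the centre of a sphere that it must avoid.
  have hsphere := hu.sphere_barrier (c := u x s) hR hRρ (fun y hy => by
    have := abs_sub_abs_le_abs_sub (u x s) (u y 0)
    rw [abs_sub_comm] at this
    linarith [h0 y (hsub hy)]) hxR ⟨hs.1, hs.2.trans_lt ht.2⟩
  have : 2 * n * s ≤ 2 * n * t := by gcongr; exact hs.2
  rw [sub_self] at hsphere
  linarith

end GraphFlowsByMeanCurvature

theorem sq_integral_le_integral_mul_integral {α : Type*} [MeasurableSpace α] {μ : Measure α}
    {f g h : α → ℝ} (hf : Integrable f μ) (hg : Integrable g μ) (hh : Integrable h μ)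
    (hf0 : 0 ≤ᵐ[μ] f) (hg0 : 0 ≤ᵐ[μ] g) (hle : ∀ᵐ x ∂μ, h x ^ 2 ≤ f x * g x) :
    (∫ x, h x ∂μ) ^ 2 ≤ (∫ x, f x ∂μ) * ∫ x, g x ∂μ := by
  have hquadratic (t : ℝ) :
      0 ≤ (∫ x, f x ∂μ) * (t * t) + 2 * (∫ x, h x ∂μ) * t + ∫ x, g x ∂μ := by
    have hsplit : ∫ x, (f x * (t * t) + 2 * h x * t + g x) ∂μ =
        (∫ x, f x ∂μ) * (t * t) + 2 * (∫ x, h x ∂μ) * t + ∫ x, g x ∂μ := by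
      rw [integral_add (by fun_prop) hg, integral_add (by fun_prop) (by fun_prop),
        integral_mul_const, integral_mul_const, integral_const_mul]
    rw [← hsplit]
    refine integral_nonneg_of_ae ?_
    filter_upwards [hf0, hg0, hle] with x (hfx : 0 ≤ f x) (hgx : 0 ≤ g x) hx
    rcases hfx.eq_or_lt with h0 | hpos
    · have : h x = 0 := by nlinarith
      simpa [← h0, this] using hgx
    · exact nonneg_of_mul_nonneg_right
        (by nlinarith [sq_nonneg (f x * t + h x)] : 0 ≤ f x * _) hpos
  have hdiscrim := discrim_le_zero hquadratic
  rw [discrim] at hdiscrim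
  linarith

section StaticEstimate

variable {n : ℕ} {φ w : ℝ^n → ℝ} {x : ℝ^n}

theorem one_le_volumeElement (w : ℝ^n → ℝ) (x : ℝ^n) : 1 ≤ volumeElement w x :=
  Real.one_le_sqrt.2 (le_add_of_nonneg_right (sq_nonneg _))

theorem continuous_volumeElement (hw : ContDiff ℝ 2 w) : Continuous (volumeElement w) :=
  continuous_iff_continuousAt.2 fun _ =>
    (differentiableAt_volumeElement hw.contDiffAt).continuousAt

/-- The area `∫ φ v dx` of the graph of `w`, weighted by `φ`. -/
noncomputable def weightedArea (φ w : ℝ^n → ℝ) : ℝ :=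
  ∫ x, φ x * volumeElement w x

/-- The integral `∫ φ H² v dx` of the squared mean curvature over the graph of `w`, weighted
by `φ`. -/
noncomputable def weightedWillmore (φ w : ℝ^n → ℝ) : ℝ :=
  ∫ x, φ x * (meanCurvature w x ^ 2 * volumeElement w x)

theorem weightedWillmore_nonneg (hφ : ∀ y, 0 ≤ φ y) : 0 ≤ weightedWillmore φ w :=
  integral_nonneg fun x =>
    mul_nonneg (hφ x) (mul_nonneg (sq_nonneg _) (volumeElement_pos w x).le)

theorem fderiv_eq_zero_of_nonneg (hφ : ∀ y, 0 ≤ φ y) (hx : φ x = 0) : fderiv ℝ φ x = 0 :=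
  IsLocalMin.fderiv_eq_zero (Eventually.of_forall fun y => hx ▸ hφ y)

theorem mul_volumeElement_le (hφ : DifferentiableAt ℝ φ x) (hφ0 : ∀ y, 0 ≤ φ y)
    (hw : ContDiffAt ℝ 2 w x) {m : ℝ} (hm : φ x ≠ 0 → |w x| ≤ m) :
    φ x * volumeElement w x ≤ φ x + m * ‖fderiv ℝ φ x‖ + m * (φ x * |meanCurvature w x|) +
      divergence (fun y => (φ y * w y) • conormal w y) x := by
  have hwx : DifferentiableAt ℝ w x := hw.differentiableAt two_ne_zero
  have hv := volumeElement_pos w x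
  have hdwN : fderiv ℝ w x (conormal w x) = volumeElement w x - (volumeElement w x)⁻¹ := by
    rw [← inner_gradient_left, inner_gradient_eq_mul_inner_conormal, real_inner_self_eq_norm_sq,
      norm_conormal_sq]
    field_simp
  have hdiv : divergence (fun y => (φ y * w y) • conormal w y) x =
      φ x * w x * meanCurvature w x + φ x * (volumeElement w x - (volumeElement w x)⁻¹) +
        w x * fderiv ℝ φ x (conormal w x) := by
    rw [divergence_smul (hφ.fun_mul hwx) (differentiableAt_conormal hw), fderiv_fun_mul hφ hwx,
      add_apply, smul_apply, smul_apply, hdwN, smul_eq_mul, smul_eq_mul, meanCurvature]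
    ring
  have hinv : φ x * (volumeElement w x)⁻¹ ≤ φ x :=
    mul_le_of_le_one_right (hφ0 x) (inv_le_one_of_one_le₀ (one_le_volumeElement w x))
  rcases (hφ0 x).eq_or_lt with h0 | hpos
  · simp [hdiv, fderiv_eq_zero_of_nonneg hφ0 h0.symm, ← h0]
  have hwm := hm hpos.ne'
  have hcurv : -(w x * meanCurvature w x) ≤ m * |meanCurvature w x| := by
    refine (neg_le_abs _).trans ?_
    rw [abs_mul]
    gcongr
  have hdφ : -(w x * fderiv ℝ φ x (conormal w x)) ≤ m * ‖fderiv ℝ φ x‖ := by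
    refine (neg_le_abs _).trans ?_
    rw [abs_mul]
    gcongr
    · exact (abs_nonneg _).trans hwm
    · exact (fderiv ℝ φ x).unit_le_opNorm _ (norm_conormal_le_one w x)
  rw [hdiv]
  linarith [mul_le_mul_of_nonneg_left hcurv (hφ0 x)]

theorem weightedArea_le (hφ : ContDiff ℝ 1 φ) (hφc : HasCompactSupport φ) (hφ0 : ∀ y, 0 ≤ φ y)
    (hw : ContDiff ℝ 2 w) {m : ℝ} (hm : ∀ y, φ y ≠ 0 → |w y| ≤ m) :
    weightedArea φ w ≤ (∫ x, φ x) + m * (∫ x, ‖fderiv ℝ φ x‖) +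
      √(m ^ 2 * (∫ x, φ x) * weightedWillmore φ w) := by
  have hv := continuous_volumeElement hw
  have hH := continuous_meanCurvature hw
  have hintφ {ψ : ℝ^n → ℝ} (hψ : Continuous ψ) : Integrable (fun x => φ x * ψ x) :=
    (hφ.continuous.mul hψ).integrable_of_hasCompactSupport hφc.mul_right
  have hφi : Integrable φ := hφ.continuous.integrable_of_hasCompactSupport hφc
  have hφH : Integrable (fun x => φ x * |meanCurvature w x|) := hintφ hH.abs
  have hdφ : Integrable (fun x => ‖fderiv ℝ φ x‖) :=
    ((hφ.continuous_fderiv one_ne_zero).integrable_of_hasCompactSupport (hφc.fderiv ℝ)).norm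
  obtain ⟨hdivi, hdiv⟩ := integral_divergence_eq_zero
    (F := fun y => (φ y * w y) • conormal w y)
    ((hφ.mul (hw.of_le (by norm_num))).smul (contDiff_conormal hw)) hφc.mul_right.smul_right
  have hmean : m * (∫ x, φ x * |meanCurvature w x|) ≤
      √(m ^ 2 * (∫ x, φ x) * weightedWillmore φ w) := by
    refine Real.le_sqrt_of_sq_le ?_
    rw [mul_pow, mul_assoc]
    refine mul_le_mul_of_nonneg_left (sq_integral_le_integral_mul_integral hφi
      (hintφ ((hH.pow 2).mul hv)) hφH (ae_of_all _ hφ0) (ae_of_all _ fun x => ?_)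
      (ae_of_all _ fun x => ?_)) (sq_nonneg m)
    · exact mul_nonneg (hφ0 x) (mul_nonneg (sq_nonneg _) (volumeElement_pos w x).le)
    · rw [mul_pow, sq_abs, sq (φ x), mul_assoc]
      gcongr
      · exact hφ0 x
      · exact hφ0 x
      · exact le_mul_of_one_le_right (sq_nonneg _) (one_le_volumeElement w x)
  calc weightedArea φ w
    _ ≤ ∫ x, (φ x + m * ‖fderiv ℝ φ x‖ + m * (φ x * |meanCurvature w x|) +
        divergence (fun y => (φ y * w y) • conormal w y) x) :=
      integral_mono (hintφ hv) (by fun_prop) fun x =>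
        mul_volumeElement_le (hφ.differentiable one_ne_zero x) hφ0 hw.contDiffAt (hm x)
    _ = (∫ x, φ x) + m * (∫ x, ‖fderiv ℝ φ x‖) + m * ∫ x, φ x * |meanCurvature w x| := by
      rw [integral_add (by fun_prop) hdivi, hdiv, add_zero, integral_add (by fun_prop)
        (by fun_prop), integral_add hφi (by fun_prop), integral_const_mul, integral_const_mul]
    _ ≤ _ := by gcongr

end StaticEstimate

section SpaceTime

variable {E : Type*} [NormedAddCommGroup E]

section NormedSpace

variable {F : Type*} [NormedSpace ℝ E] [NormedAddCommGroup F] [NormedSpace ℝ F] {U : E → ℝ → F}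

theorem contDiff_slice {m : ℕ∞ω} (hU : ContDiff ℝ m (Function.uncurry U)) (t : ℝ) :
    ContDiff ℝ m (U · t) :=
  hU.comp (f := fun y => (y, t)) (by fun_prop)

theorem contDiff_deriv_slice {m k : ℕ∞ω} (hU : ContDiff ℝ m (Function.uncurry U))
    (hk : k + 1 ≤ m) : ContDiff ℝ k (fun p : E × ℝ => deriv (U p.1) p.2) := by
  have hcurry : ContDiff ℝ m (Function.uncurry fun (p : E × ℝ) s => U p.1 s) :=
    hU.comp (f := fun q : (E × ℝ) × ℝ => (q.1.1, q.2)) (by fun_prop)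
  exact (hcurry.fderiv contDiff_snd hk).clm_apply contDiff_const

theorem fderiv_slice (hU : Differentiable ℝ (Function.uncurry U)) (x : E) (t : ℝ) (h : E) :
    fderiv ℝ (U · t) x h = fderiv ℝ (Function.uncurry U) (x, t) (h, 0) := by
  have hpair : HasFDerivAt (fun y => (y, t)) (ContinuousLinearMap.inl ℝ E ℝ) x :=
    hasFDerivAt_prodMk_left x t
  have hcomp : HasFDerivAt (U · t)
      ((fderiv ℝ (Function.uncurry U) (x, t)).comp (ContinuousLinearMap.inl ℝ E ℝ)) x :=
    HasFDerivAt.comp (g := Function.uncurry U) x (hU (x, t)).hasFDerivAt hpair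
  simp [hcomp.fderiv]

theorem deriv_slice (hU : Differentiable ℝ (Function.uncurry U)) (x : E) (t : ℝ) :
    deriv (U x) t = fderiv ℝ (Function.uncurry U) (x, t) (0, 1) :=
  ((hU (x, t)).hasFDerivAt.comp_hasDerivAt t
    ((hasDerivAt_const t x).prodMk (hasDerivAt_id t))).deriv

theorem hasDerivAt_fderiv_slice (hU : ContDiff ℝ 2 (Function.uncurry U)) (x : E) (t : ℝ) (h : E) :
    HasDerivAt (fun s => fderiv ℝ (U · s) x h) (fderiv ℝ (fun y => deriv (U y) t) x h) t := by
  have hdiff : Differentiable ℝ (Function.uncurry U) := hU.differentiable two_ne_zero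
  have hD : Differentiable ℝ (fderiv ℝ (Function.uncurry U)) :=
    (hU.fderiv_right (m := 1) (by norm_num)).differentiable one_ne_zero
  have hspace : DifferentiableAt ℝ (fun p => fderiv ℝ (Function.uncurry U) p (h, 0)) (x, t) :=
    (hD _).clm_apply (differentiableAt_const _)
  have htime : Differentiable ℝ (Function.uncurry fun y s =>
      fderiv ℝ (Function.uncurry U) (y, s) (0, 1)) :=
    fun p => (hD p).clm_apply (differentiableAt_const _)
  have hcomm := (hU.contDiffAt (x := (x, t))).isSymmSndFDerivAt (by simp) (0, 1) (h, 0)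
  simp only [fderiv_slice hdiff, deriv_slice hdiff]
  refine (hspace.hasFDerivAt.comp_hasDerivAt t
    ((hasDerivAt_const t x).prodMk (hasDerivAt_id t))).congr_deriv ?_
  rw [fderiv_slice htime]
  unfold Function.uncurry at *
  rw [fderiv_clm_apply (hD _) (differentiableAt_const _),
    fderiv_clm_apply (hD _) (differentiableAt_const _)]
  simpa using hcomm

end NormedSpace

variable [InnerProductSpace ℝ E] [CompleteSpace E] {U : E → ℝ → ℝ}

theorem contDiff_gradient_slice {m k : ℕ∞ω} (hU : ContDiff ℝ m (Function.uncurry U))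
    (hk : k + 1 ≤ m) : ContDiff ℝ k (fun p : E × ℝ => gradient (U · p.2) p.1) := by
  have hswap : ContDiff ℝ m (Function.uncurry fun (p : E × ℝ) y => U y p.2) :=
    hU.comp (f := fun q : (E × ℝ) × E => (q.2, q.1.2)) (by fun_prop)
  exact (InnerProductSpace.toDual ℝ E).symm.contDiff.comp (hswap.fderiv contDiff_fst hk)

theorem hasDerivAt_gradient_slice (hU : ContDiff ℝ 2 (Function.uncurry U)) (x : E) (t : ℝ) :
    HasDerivAt (fun s => gradient (U · s) x) (gradient (fun y => deriv (U y) t) x) t := by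
  have hgrad : DifferentiableAt ℝ (fun s => gradient (U · s) x) t :=
    ((contDiff_gradient_slice hU (k := 1) (by norm_num)).comp (f := fun s : ℝ => (x, s))
      (by fun_prop)).differentiable one_ne_zero t
  convert hgrad.hasDerivAt using 1
  refine ext_inner_right ℝ fun h => ?_
  have hinner := hgrad.hasDerivAt.inner ℝ (hasDerivAt_const t h)
  simp only [inner_gradient_left, inner_zero_right, zero_add] at hinner
  exact (inner_gradient_left ..).trans ((hasDerivAt_fderiv_slice hU x t h).unique hinner)

end SpaceTime

section SpaceTimeGraph

variable {n : ℕ} {U : ℝ^n → ℝ → ℝ}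

theorem contDiff_volumeElement_slice (hU : ContDiff ℝ 2 (Function.uncurry U)) :
    ContDiff ℝ 1 (fun p : ℝ^n × ℝ => volumeElement (U · p.2) p.1) :=
  (contDiff_const.add ((contDiff_gradient_slice hU (by norm_num)).norm_sq ℝ)).sqrt
    fun _ => by positivity

theorem hasDerivAt_volumeElement_slice (hU : ContDiff ℝ 2 (Function.uncurry U)) (x : ℝ^n)
    (t : ℝ) : HasDerivAt (fun s => volumeElement (U · s) x)
      (fderiv ℝ (fun y => deriv (U y) t) x (conormal (U · t) x)) t := by
  refine (((hasDerivAt_gradient_slice hU x t).norm_sq.const_add 1).sqrt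
    (by positivity)).congr_deriv ?_
  rw [← inner_gradient_left, conormal, real_inner_smul_right, real_inner_comm, volumeElement]
  field_simp

end SpaceTimeGraph

theorem hasDerivAt_integral_of_contDiff {E F : Type*} [NormedAddCommGroup E] [NormedSpace ℝ E]
    [MeasurableSpace E] [BorelSpace E] [SecondCountableTopology E] {μ : Measure E}
    [IsFiniteMeasureOnCompacts μ] [NormedAddCommGroup F] [NormedSpace ℝ F] {g : E → ℝ → F}
    (hg : ContDiff ℝ 1 (Function.uncurry g)) {K : Set E} (hK : IsCompact K) {s : Set ℝ}
    (hs : IsOpen s) (hgK : ∀ t ∈ s, ∀ x ∉ K, g x t = 0) {t : ℝ} (ht : t ∈ s) :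
    Integrable (fun x => deriv (g x) t) μ ∧
      HasDerivAt (fun t => ∫ x, g x t ∂μ) (∫ x, deriv (g x) t ∂μ) t := by
  obtain ⟨ε, hε, hεs⟩ := Metric.nhds_basis_closedBall.mem_iff.1 (hs.mem_nhds ht)
  have hderiv (x : E) (r : ℝ) : HasDerivAt (g x) (deriv (g x) r) r :=
    ((hg.comp (f := fun r : ℝ => (x, r)) (by fun_prop)).differentiable one_ne_zero r).hasDerivAt
  have hcont : Continuous (fun p : E × ℝ => deriv (g p.1) p.2) :=
    (contDiff_deriv_slice hg (k := 0) (by simp)).continuous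
  obtain ⟨C, hC⟩ := (hK.prod (isCompact_closedBall t ε)).exists_bound_of_continuousOn
    hcont.continuousOn
  have hzero (r : ℝ) (hr : r ∈ s) (x : E) (hx : x ∉ K) : deriv (g x) r = 0 := by
    have : g x =ᶠ[𝓝 r] fun _ => 0 := by
      filter_upwards [hs.mem_nhds hr] with r' hr' using hgK r' hr' x hx
    rw [this.deriv_eq, deriv_const]
  refine hasDerivAt_integral_of_dominated_loc_of_deriv_le (F := fun t x => g x t)
    (F' := fun t x => deriv (g x) t) (bound := K.indicator fun _ => C)
    (Metric.ball_mem_nhds t hε) ?_ ?_ ?_ ?_ ?_ ?_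
  · exact Eventually.of_forall fun r =>
      (hg.continuous.comp (by fun_prop : Continuous fun x => (x, r))).aestronglyMeasurable
  · exact (hg.continuous.comp (by fun_prop :
      Continuous fun x => (x, t))).integrable_of_hasCompactSupport
        (HasCompactSupport.intro hK fun x hx => hgK t ht x hx)
  · exact (hcont.comp (by fun_prop : Continuous fun x => (x, t))).aestronglyMeasurable
  · refine Eventually.of_forall fun x r hr => ?_
    by_cases hx : x ∈ K
    · rw [indicator_of_mem hx]
      exact hC (x, r) ⟨hx, Metric.ball_subset_closedBall hr⟩
    · rw [indicator_of_notMem hx, hzero r (hεs (Metric.ball_subset_closedBall hr)) x hx, norm_zero]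
  · exact (integrable_indicator_iff hK.measurableSet).2 (integrableOn_const hK.measure_lt_top.ne)
  · exact Eventually.of_forall fun x r _ => hderiv x r

theorem hasDerivAt_max_zero_pow (k : ℕ) (s : ℝ) :
    HasDerivAt (fun s : ℝ => max s 0 ^ (k + 2)) ((k + 2) * max s 0 ^ (k + 1)) s := by
  rcases lt_trichotomy s 0 with hs | rfl | hs
  · have hzero : (fun s : ℝ => max s 0 ^ (k + 2)) =ᶠ[𝓝 s] fun _ => 0 := by
      filter_upwards [Iio_mem_nhds hs] with r (hr : r < 0)
      simp [max_eq_right hr.le]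
    simpa [max_eq_right hs.le] using (hasDerivAt_const s (0 : ℝ)).congr_of_eventuallyEq hzero
  · have hflat : HasFDerivAt (fun s : ℝ => max s 0 ^ (k + 2)) (0 : ℝ →L[ℝ] ℝ) 0 := by
      refine Asymptotics.IsBigO.hasFDerivAt (n := k + 2)
        (Asymptotics.IsBigO.of_bound 1 (Eventually.of_forall fun r => ?_)) (by omega)
      simp only [sub_zero, norm_pow, norm_norm, one_mul]
      gcongr
      rw [Real.norm_of_nonneg (le_max_right _ _)]
      exact max_le (le_abs_self r) (abs_nonneg r)
    simpa using hflat.hasDerivAt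
  · have hpow : (fun s : ℝ => max s 0 ^ (k + 2)) =ᶠ[𝓝 s] fun r => r ^ (k + 2) := by
      filter_upwards [Ioi_mem_nhds hs] with r (hr : 0 < r)
      simp [max_eq_left hr.le]
    simpa [max_eq_left hs.le] using (hasDerivAt_pow (k + 2) s).congr_of_eventuallyEq hpow

theorem contDiff_max_zero_pow (k : ℕ) : ContDiff ℝ 1 (fun s : ℝ => max s 0 ^ (k + 2)) := by
  refine contDiff_one_iff_deriv.2 ⟨fun s => (hasDerivAt_max_zero_pow k s).differentiableAt, ?_⟩
  simp only [funext fun s => (hasDerivAt_max_zero_pow k s).deriv]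
  fun_prop

section HeatCutoff

variable {n : ℕ} {ρ t : ℝ} {x : ℝ^n}

/-- The positive part `η = (ρ² - |x|² - 2nt)₊`, a localization to a shrinking ball; the function
`|x|² + 2nt` solves the heat equation. -/
noncomputable def heatCutoff (ρ t : ℝ) (x : ℝ^n) : ℝ :=
  max (ρ ^ 2 - ‖x‖ ^ 2 - 2 * n * t) 0

theorem heatCutoff_nonneg (ρ t : ℝ) (x : ℝ^n) : 0 ≤ heatCutoff ρ t x :=
  le_max_right _ _

theorem heatCutoff_le_sq (ht : 0 ≤ t) (x : ℝ^n) : heatCutoff ρ t x ≤ ρ ^ 2 := by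
  refine max_le ?_ (sq_nonneg ρ)
  have : 0 ≤ 2 * n * t := by positivity
  linarith [sq_nonneg ‖x‖]

theorem heatCutoff_pos_iff : 0 < heatCutoff ρ t x ↔ ‖x‖ ^ 2 + 2 * n * t < ρ ^ 2 := by
  rw [heatCutoff, lt_max_iff, or_iff_left (lt_irrefl _), sub_sub, sub_pos]

theorem mem_closedBall_of_heatCutoff_pos (hρ : 0 ≤ ρ) (ht : 0 ≤ t) (hx : 0 < heatCutoff ρ t x) :
    x ∈ Metric.closedBall 0 ρ := by
  rw [heatCutoff_pos_iff] at hx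
  have : 0 ≤ 2 * n * t := by positivity
  exact mem_closedBall_zero_iff.2 (lt_of_pow_lt_pow_left₀ 2 hρ (by linarith)).le

theorem heatCutoff_eq_zero (hρ : 0 ≤ ρ) (ht : 0 ≤ t) (hx : x ∉ Metric.closedBall 0 ρ) :
    heatCutoff ρ t x = 0 := by
  by_contra hne
  exact hx (mem_closedBall_of_heatCutoff_pos hρ ht ((heatCutoff_nonneg ρ t x).lt_of_ne' hne))

theorem hasCompactSupport_heatCutoff (hρ : 0 ≤ ρ) (ht : 0 ≤ t) :
    HasCompactSupport (heatCutoff (n := n) ρ t) :=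
  HasCompactSupport.intro (isCompact_closedBall 0 ρ) fun _ hx => heatCutoff_eq_zero hρ ht hx

theorem contDiff_heatCutoff_pow (ρ : ℝ) (k : ℕ) :
    ContDiff ℝ 1 (fun p : ℝ^n × ℝ => heatCutoff ρ p.2 p.1 ^ (k + 2)) := by
  have := (contDiff_fst (𝕜 := ℝ) (n := 1) (E := ℝ^n) (F := ℝ)).norm_sq ℝ
  exact (contDiff_max_zero_pow k).comp
    (f := fun p : ℝ^n × ℝ => ρ ^ 2 - ‖p.1‖ ^ 2 - 2 * n * p.2) (by fun_prop)

theorem contDiff_heatCutoff_pow_slice (ρ t : ℝ) (k : ℕ) :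
    ContDiff ℝ 1 (fun x : ℝ^n => heatCutoff ρ t x ^ (k + 2)) :=
  contDiff_slice (U := fun x s => heatCutoff ρ s x ^ (k + 2)) (contDiff_heatCutoff_pow ρ k) t

theorem hasFDerivAt_heatCutoff_pow (ρ t : ℝ) (k : ℕ) (x : ℝ^n) :
    HasFDerivAt (fun y => heatCutoff ρ t y ^ (k + 2))
      ((-2 * (k + 2) * heatCutoff ρ t x ^ (k + 1)) • innerSL ℝ x) x := by
  have hinner : HasFDerivAt (fun y : ℝ^n => ρ ^ 2 - ‖y‖ ^ 2 - 2 * n * t) _ x :=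
    ((hasFDerivAt_id x).norm_sq.const_sub (ρ ^ 2)).sub_const (2 * n * t)
  refine ((hasDerivAt_max_zero_pow k _).comp_hasFDerivAt x hinner).congr_fderiv ?_
  ext h
  simp only [id_eq, ContinuousLinearMap.comp_id, smul_neg, neg_apply, smul_apply,
    coe_innerSL_apply, nsmul_eq_mul, Nat.cast_ofNat, smul_eq_mul, neg_mul, heatCutoff, neg_smul,
    neg_inj]
  ring

theorem hasDerivAt_heatCutoff_pow (ρ t : ℝ) (k : ℕ) (x : ℝ^n) :
    HasDerivAt (fun s => heatCutoff ρ s x ^ (k + 2))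
      (-(2 * n) * (k + 2) * heatCutoff ρ t x ^ (k + 1)) t := by
  have hinner : HasDerivAt (fun s : ℝ => ρ ^ 2 - ‖x‖ ^ 2 - 2 * n * s) _ t :=
    ((hasDerivAt_id t).const_mul (2 * n : ℝ)).const_sub (ρ ^ 2 - ‖x‖ ^ 2)
  refine ((hasDerivAt_max_zero_pow k _).comp t hinner).congr_deriv ?_
  simp only [mul_one, mul_neg, neg_mul, heatCutoff, neg_inj]
  ring

theorem norm_fderiv_heatCutoff_cube_le (hρ : 0 ≤ ρ) (ht : 0 ≤ t) (x : ℝ^n) :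
    ‖fderiv ℝ (fun y => heatCutoff ρ t y ^ 3) x‖ ≤ 6 * ρ ^ 5 := by
  have hη := heatCutoff_nonneg ρ t x
  rw [(hasFDerivAt_heatCutoff_pow ρ t 1 x).fderiv, norm_smul, innerSL_apply_norm, Real.norm_eq_abs]
  rcases hη.eq_or_lt with h0 | hpos
  · simpa [← h0] using pow_nonneg hρ 5
  · have hx : ‖x‖ ≤ ρ := mem_closedBall_zero_iff.1 (mem_closedBall_of_heatCutoff_pos hρ ht hpos)
    calc |-2 * ((1 : ℕ) + 2) * heatCutoff ρ t x ^ (1 + 1)| * ‖x‖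
      _ = 6 * heatCutoff ρ t x ^ 2 * ‖x‖ := by
        rw [abs_mul, abs_of_nonneg (pow_nonneg hη _)]
        norm_num
      _ ≤ 6 * (ρ ^ 2) ^ 2 * ρ := by
        gcongr
        exact heatCutoff_le_sq ht x
      _ = 6 * ρ ^ 5 := by ring

theorem divergence_heatCutoff_pow_smul {F : ℝ^n → ℝ^n} (hF : DifferentiableAt ℝ F x) (ρ t : ℝ)
    (k : ℕ) : divergence (fun y => heatCutoff ρ t y ^ (k + 2) • F y) x =
      heatCutoff ρ t x ^ (k + 2) * divergence F x -
        2 * (k + 2) * heatCutoff ρ t x ^ (k + 1) * inner ℝ x (F x) := by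
  have hη := hasFDerivAt_heatCutoff_pow ρ t k x
  rw [divergence_smul hη.differentiableAt hF, hη.fderiv, smul_apply, innerSL_apply_apply,
    smul_eq_mul]
  ring

end HeatCutoff

section Energy

variable {n : ℕ} {U : ℝ^n → ℝ → ℝ} {ρ t : ℝ}

theorem hasDerivAt_heatCutoff_mul_volumeElement (hU : ContDiff ℝ 2 (Function.uncurry U)) (ρ t : ℝ)
    (x : ℝ^n) : HasDerivAt (fun s => heatCutoff ρ s x ^ 3 * volumeElement (U · s) x)
      (-(6 * n) * heatCutoff ρ t x ^ 2 * volumeElement (U · t) x +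
        heatCutoff ρ t x ^ 3 * fderiv ℝ (fun y => deriv (U y) t) x (conormal (U · t) x)) t := by
  refine ((hasDerivAt_heatCutoff_pow ρ t 1 x).mul
    (hasDerivAt_volumeElement_slice hU x t)).congr_deriv ?_
  push_cast
  ring

theorem contDiff_deriv_slice_space (hU : ContDiff ℝ 2 (Function.uncurry U)) (t : ℝ) :
    ContDiff ℝ 1 (fun y => deriv (U y) t) :=
  contDiff_slice (U := fun y s => deriv (U y) s) (contDiff_deriv_slice hU (by norm_num)) t

theorem contDiff_deriv_smul_conormal (hU : ContDiff ℝ 2 (Function.uncurry U)) (t : ℝ) :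
    ContDiff ℝ 1 (fun y => deriv (U y) t • conormal (U · t) y) :=
  (contDiff_deriv_slice_space hU t).fun_smul (contDiff_conormal (contDiff_slice hU t))

theorem divergence_deriv_smul_conormal (hU : ContDiff ℝ 2 (Function.uncurry U)) (t : ℝ)
    (x : ℝ^n) : divergence (fun y => deriv (U y) t • conormal (U · t) y) x =
      deriv (U x) t * meanCurvature (U · t) x +
        fderiv ℝ (fun y => deriv (U y) t) x (conormal (U · t) x) :=
  divergence_smul ((contDiff_deriv_slice_space hU t).differentiable one_ne_zero x)
    (differentiableAt_conormal (contDiff_slice hU t).contDiffAt)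

theorem deriv_heatCutoff_mul_volumeElement_le (hU : ContDiff ℝ 2 (Function.uncurry U)) {x : ℝ^n}
    (hflow : 0 < heatCutoff ρ t x →
      deriv (U x) t = volumeElement (U · t) x * meanCurvature (U · t) x) :
    deriv (fun s => heatCutoff ρ s x ^ 3 * volumeElement (U · s) x) t ≤
      divergence (fun y => heatCutoff ρ t y ^ 3 • deriv (U y) t • conormal (U · t) y) x -
      6 * divergence (fun y => heatCutoff ρ t y ^ 2 • positionField (U · t) y) x -
      heatCutoff ρ t x ^ 3 * (meanCurvature (U · t) x ^ 2 * volumeElement (U · t) x) := by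
  have hw : ContDiff ℝ 2 (U · t) := contDiff_slice hU t
  have hη := heatCutoff_nonneg ρ t x
  have hv := (volumeElement_pos (U · t) x).le
  have hdivN := divergence_heatCutoff_pow_smul
    ((contDiff_deriv_smul_conormal hU t).differentiable one_ne_zero x) ρ t 1
  have hdivY := divergence_heatCutoff_pow_smul
    ((contDiff_positionField hw).differentiable one_ne_zero x) ρ t 0
  have hflow' : heatCutoff ρ t x ^ 2 * deriv (U x) t =
      heatCutoff ρ t x ^ 2 * (volumeElement (U · t) x * meanCurvature (U · t) x) := by
    rcases hη.eq_or_lt with h0 | hpos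
    · simp [← h0]
    · rw [hflow hpos]
  have hslack : 0 ≤ 6 * heatCutoff ρ t x ^ 2 * volumeElement (U · t) x *
      ‖conormal (U · t) x‖ ^ 2 + 24 * heatCutoff ρ t x * inner ℝ x (positionField (U · t) x) :=
    add_nonneg (by positivity) (mul_nonneg (by positivity) (inner_positionField_nonneg _ _))
  rw [(hasDerivAt_heatCutoff_mul_volumeElement hU ρ t x).deriv, hdivN, hdivY,
    divergence_deriv_smul_conormal hU, divergence_positionField hw.contDiffAt,
    inner_gradient_eq_mul_inner_conormal, real_inner_smul_right, real_inner_comm x]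
  push_cast
  linear_combination hslack +
    (6 * inner ℝ x (conormal (U · t) x) - heatCutoff ρ t x * meanCurvature (U · t) x) * hflow'

theorem hasDerivAt_weightedArea (hU : ContDiff ℝ 2 (Function.uncurry U)) (hρ : 0 ≤ ρ) (ht : 0 < t)
    (hflow : ∀ x, 0 < heatCutoff ρ t x →
      deriv (U x) t = volumeElement (U · t) x * meanCurvature (U · t) x) :
    ∃ A' ≤ -weightedWillmore (fun x => heatCutoff ρ t x ^ 3) (U · t),
      HasDerivAt (fun s => weightedArea (fun x => heatCutoff ρ s x ^ 3) (U · s)) A' t := by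
  have hw : ContDiff ℝ 2 (U · t) := contDiff_slice hU t
  have hη (k : ℕ) : ContDiff ℝ 1 fun x : ℝ^n => heatCutoff ρ t x ^ (k + 2) :=
    contDiff_heatCutoff_pow_slice ρ t k
  have hηc (k : ℕ) : HasCompactSupport fun x : ℝ^n => heatCutoff ρ t x ^ (k + 2) :=
    (hasCompactSupport_heatCutoff hρ ht.le).comp_left (g := (· ^ (k + 2))) (by simp)
  obtain ⟨hdivNi, hdivN⟩ := integral_divergence_eq_zero
    ((hη 1).smul (contDiff_deriv_smul_conormal hU t)) (hηc 1).smul_right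
  obtain ⟨hdivYi, hdivY⟩ := integral_divergence_eq_zero
    ((hη 0).smul (contDiff_positionField hw)) (hηc 0).smul_right
  have hBi : Integrable fun x =>
      heatCutoff ρ t x ^ 3 * (meanCurvature (U · t) x ^ 2 * volumeElement (U · t) x) := by
    have hv := continuous_volumeElement hw
    have hH := continuous_meanCurvature hw
    exact ((hη 1).continuous.mul ((hH.pow 2).mul hv)).integrable_of_hasCompactSupport
      (hηc 1).mul_right
  have hφv : ContDiff ℝ 1 (Function.uncurry fun x s =>
      heatCutoff ρ s x ^ 3 * volumeElement (U · s) x) := by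
    unfold Function.uncurry
    exact (contDiff_heatCutoff_pow ρ 1).mul (contDiff_volumeElement_slice hU)
  obtain ⟨hderivi, hderiv⟩ := hasDerivAt_integral_of_contDiff (μ := volume) hφv
    (isCompact_closedBall 0 ρ) isOpen_Ioi
    (fun s (hs : 0 < s) x hx => by simp [heatCutoff_eq_zero hρ hs.le hx]) ht
  have hle := integral_mono hderivi ((hdivNi.sub (hdivYi.const_mul 6)).sub hBi) fun x =>
    deriv_heatCutoff_mul_volumeElement_le hU (hflow x)
  refine ⟨_, hle.trans_eq ?_, hderiv⟩
  rw [integral_sub' (hdivNi.sub (hdivYi.const_mul 6)) hBi,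
    integral_sub' hdivNi (hdivYi.const_mul 6), integral_const_mul, hdivN, hdivY,
    mul_zero, sub_zero, zero_sub, weightedWillmore]

end Energy

section Riccati

variable {A A' B : ℝ → ℝ} {a b : ℝ}

theorem le_div_of_mul_deriv_le_neg_sq {C : ℝ} (hab : a < b) (hC : 0 ≤ C)
    (hA : ∀ t ∈ Icc a b, HasDerivAt A (A' t) t) (hpos : ∀ t ∈ Icc a b, 0 < A t)
    (hA' : ∀ t ∈ Icc a b, C * A' t ≤ -A t ^ 2) : A b ≤ C / (b - a) := by
  have hderiv (t : ℝ) (ht : t ∈ Icc a b) :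
      HasDerivAt (fun t => C * (A t)⁻¹ - t) (C * (-A' t / A t ^ 2) - 1) t :=
    (((hA t ht).fun_inv (hpos t ht).ne').const_mul C).sub (hasDerivAt_id t)
  have hmono : MonotoneOn (fun t => C * (A t)⁻¹ - t) (Icc a b) := by
    refine monotoneOn_of_hasDerivWithinAt_nonneg (convex_Icc a b)
      (fun t ht => (hderiv t ht).continuousAt.continuousWithinAt)
      (fun t ht => (hderiv t (interior_subset ht)).hasDerivWithinAt) fun t ht => ?_
    have := hA' t (interior_subset ht)
    have := hpos t (interior_subset ht)
    rw [sub_nonneg, mul_div_assoc', le_div_iff₀ (by positivity)]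
    linarith
  have hb := right_mem_Icc.2 hab.le
  have ha := left_mem_Icc.2 hab.le
  have hle : C * (A a)⁻¹ - a ≤ C * (A b)⁻¹ - b := hmono ha hb hab.le
  have : 0 ≤ C * (A a)⁻¹ := mul_nonneg hC (inv_nonneg.2 (hpos a ha).le)
  rw [le_div_comm₀ (hpos b hb) (sub_pos.2 hab), div_eq_mul_inv]
  linarith

theorem le_of_riccati {K D : ℝ} (hab : a < b) (hK : 0 ≤ K) (hD : 0 ≤ D)
    (hA : ∀ t ∈ Icc a b, HasDerivAt A (A' t) t) (hA' : ∀ t ∈ Icc a b, A' t ≤ -B t)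
    (hB : ∀ t ∈ Icc a b, 0 ≤ B t) (hAB : ∀ t ∈ Icc a b, A t ≤ K + √(D * B t)) :
    A b ≤ 2 * K + 4 * D / (b - a) := by
  have hanti : AntitoneOn A (Icc a b) :=
    antitoneOn_of_hasDerivWithinAt_nonpos (convex_Icc a b)
      (fun t ht => (hA t ht).continuousAt.continuousWithinAt)
      (fun t ht => (hA t (interior_subset ht)).hasDerivWithinAt)
      fun t ht => by linarith [hA' t (interior_subset ht), hB t (interior_subset ht)]
  rcases le_or_gt (A b) (2 * K) with hle | hlt
  · have : 0 ≤ 4 * D / (b - a) := div_nonneg (by positivity) (sub_pos.2 hab).le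
    linarith
  have hbig (t : ℝ) (ht : t ∈ Icc a b) : 2 * K < A t :=
    hlt.trans_le (hanti ht (right_mem_Icc.2 hab.le) ht.2)
  have hsq (t : ℝ) (ht : t ∈ Icc a b) : A t ^ 2 ≤ 4 * (D * B t) := by
    have hhalf : A t / 2 ≤ √(D * B t) := by linarith [hbig t ht, hAB t ht]
    have := Real.le_sqrt' (by linarith [hbig t ht]) |>.1 hhalf
    linarith
  have := le_div_of_mul_deriv_le_neg_sq (C := 4 * D) hab (by positivity) hA
    (fun t ht => by linarith [hbig t ht]) fun t ht => by
      have := mul_le_mul_of_nonneg_left (hA' t ht) (by positivity : 0 ≤ 4 * D)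
      linarith [hsq t ht]
  linarith

end Riccati

theorem norm_integral_le_mul_measureReal {α F : Type*} [MeasurableSpace α] {μ : Measure α}
    [NormedAddCommGroup F] [NormedSpace ℝ F] {f : α → F} {K : Set α} {C : ℝ} (hK : μ K < ⊤)
    (hfC : ∀ x ∈ K, ‖f x‖ ≤ C) (hf0 : ∀ x ∉ K, f x = 0) :
    ‖∫ x, f x ∂μ‖ ≤ C * μ.real K := by
  rw [← setIntegral_eq_integral_of_forall_compl_eq_zero hf0]
  exact norm_setIntegral_le_of_norm_le_const hK hfC

section LocalEstimate

variable {n : ℕ} {U : ℝ^n → ℝ → ℝ} {w : ℝ^n → ℝ} {ρ t m : ℝ}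

theorem integral_heatCutoff_cube_le (hρ : 0 ≤ ρ) (ht : 0 ≤ t) :
    ∫ x : ℝ^n, heatCutoff ρ t x ^ 3 ≤ ρ ^ 6 * volume.real (Metric.closedBall (0 : ℝ^n) ρ) := by
  refine (Real.le_norm_self _).trans (norm_integral_le_mul_measureReal measure_closedBall_lt_top
    (fun x _ => ?_) fun x hx => by simp [heatCutoff_eq_zero hρ ht hx])
  rw [norm_pow, Real.norm_of_nonneg (heatCutoff_nonneg ρ t x), show ρ ^ 6 = (ρ ^ 2) ^ 3 by ring]
  gcongr
  exacts [heatCutoff_nonneg ρ t x, heatCutoff_le_sq ht x]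

theorem integral_norm_fderiv_heatCutoff_cube_le (hρ : 0 ≤ ρ) (ht : 0 ≤ t) :
    ∫ x : ℝ^n, ‖fderiv ℝ (fun y => heatCutoff ρ t y ^ 3) x‖ ≤
      6 * ρ ^ 5 * volume.real (Metric.closedBall (0 : ℝ^n) ρ) := by
  refine (Real.le_norm_self _).trans (norm_integral_le_mul_measureReal measure_closedBall_lt_top
    (fun x _ => ?_) fun x hx => ?_)
  · rw [norm_norm]
    exact norm_fderiv_heatCutoff_cube_le hρ ht x
  · rw [(hasFDerivAt_heatCutoff_pow ρ t 1 x).fderiv, heatCutoff_eq_zero hρ ht hx]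
    simp

theorem weightedArea_heatCutoff_le (hρ : 0 ≤ ρ) (ht : 0 ≤ t) (hw : ContDiff ℝ 2 w) (hρm : ρ ≤ m)
    (hm : ∀ x, 0 < heatCutoff ρ t x → |w x| ≤ m) :
    weightedArea (fun x => heatCutoff ρ t x ^ 3) w ≤
      7 * (ρ ^ 4 * m ^ 2 * volume.real (Metric.closedBall (0 : ℝ^n) ρ)) +
        √(ρ ^ 6 * m ^ 2 * volume.real (Metric.closedBall (0 : ℝ^n) ρ) *
          weightedWillmore (fun x => heatCutoff ρ t x ^ 3) w) := by
  set V := volume.real (Metric.closedBall (0 : ℝ^n) ρ)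
  have hm0 : 0 ≤ m := hρ.trans hρm
  have hη := heatCutoff_nonneg (n := n) ρ t
  have hφc : HasCompactSupport fun x : ℝ^n => heatCutoff ρ t x ^ 3 :=
    (hasCompactSupport_heatCutoff hρ ht).comp_left (g := (· ^ 3)) (by simp)
  have hφ := integral_heatCutoff_cube_le (n := n) hρ ht
  have hdφ := integral_norm_fderiv_heatCutoff_cube_le (n := n) hρ ht
  have hB : 0 ≤ weightedWillmore (fun x => heatCutoff ρ t x ^ 3) w :=
    weightedWillmore_nonneg fun x => pow_nonneg (hη x) 3
  refine (weightedArea_le (contDiff_heatCutoff_pow_slice ρ t 1) hφc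
    (fun x => pow_nonneg (hη x) 3) hw fun x hx => hm x ?_).trans (add_le_add ?_ ?_)
  · exact (hη x).lt_of_ne' (pow_ne_zero_iff three_ne_zero |>.1 hx)
  · calc (∫ x, heatCutoff ρ t x ^ 3) + m * ∫ x, ‖fderiv ℝ (fun y => heatCutoff ρ t y ^ 3) x‖
      _ ≤ ρ ^ 4 * (ρ * ρ) * V + m * (6 * (ρ ^ 4 * ρ) * V) := by
        gcongr
        · exact hφ.trans_eq (by ring)
        · exact hdφ.trans_eq (by ring)
      _ ≤ ρ ^ 4 * (m * m) * V + m * (6 * (ρ ^ 4 * m) * V) := by gcongr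
      _ = 7 * (ρ ^ 4 * m ^ 2 * V) := by ring
  · refine Real.sqrt_le_sqrt (mul_le_mul_of_nonneg_right ?_ hB)
    calc m ^ 2 * ∫ x, heatCutoff ρ t x ^ 3
      _ ≤ m ^ 2 * (ρ ^ 6 * V) := by gcongr
      _ = ρ ^ 6 * m ^ 2 * V := by ring

theorem weightedArea_heatCutoff_le_of_flow {a b : ℝ} (hU : ContDiff ℝ 2 (Function.uncurry U))
    (hρ : 0 ≤ ρ) (ha : 0 < a) (hab : a < b) (hρm : ρ ≤ m)
    (hflow : ∀ t ∈ Icc a b, ∀ x, 0 < heatCutoff ρ t x →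
      deriv (U x) t = volumeElement (U · t) x * meanCurvature (U · t) x)
    (hm : ∀ t ∈ Icc a b, ∀ x, 0 < heatCutoff ρ t x → |U x t| ≤ m) :
    weightedArea (fun x => heatCutoff ρ b x ^ 3) (U · b) ≤
      ρ ^ 4 * m ^ 2 * volume.real (Metric.closedBall (0 : ℝ^n) ρ) * (14 + 4 * ρ ^ 2 / (b - a)) := by
  have hpos (t : ℝ) (ht : t ∈ Icc a b) : 0 < t := ha.trans_le ht.1
  choose! A' hA' hA using fun t (ht : t ∈ Icc a b) =>
    hasDerivAt_weightedArea hU hρ (hpos t ht) (hflow t ht)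
  refine (le_of_riccati hab (by positivity) (by positivity) hA hA' (fun t _ =>
    weightedWillmore_nonneg fun x => pow_nonneg (heatCutoff_nonneg ρ t x) 3) fun t ht =>
      weightedArea_heatCutoff_le hρ (hpos t ht).le (contDiff_slice hU t) hρm (hm t ht)).trans_eq
        (by ring)

end LocalEstimate

theorem exists_contDiff_eventuallyEq {E F : Type*} [NormedAddCommGroup E] [NormedSpace ℝ E]
    [FiniteDimensional ℝ E] [NormedAddCommGroup F] [NormedSpace ℝ F] {k : ℕ∞} {f : E → F}
    {Ω K : Set E} (hΩ : IsOpen Ω) (hK : IsCompact K) (hKΩ : K ⊆ Ω)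
    (hf : ∀ z ∈ Ω, ContDiffAt ℝ k f z) :
    ∃ g : E → F, ContDiff ℝ k g ∧ ∀ z ∈ K, g =ᶠ[𝓝 z] f := by
  obtain ⟨L, hL, hKL, hLΩ⟩ := exists_compact_between hK hΩ hKΩ
  obtain ⟨χ, hχ1, hχ0, -⟩ := exists_contMDiffMap_one_nhds_of_subset_interior (n := k)
    (modelWithCornersSelf ℝ E) hK.isClosed hKL
  have hχ : ContDiff ℝ k χ := χ.contMDiff.contDiff
  refine ⟨fun z => χ z • f z, contDiff_iff_contDiffAt.2 fun z => ?_, fun z hz => ?_⟩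
  · by_cases hz : z ∈ Ω
    · exact hχ.contDiffAt.smul (hf z hz)
    · refine (contDiffAt_const (c := 0)).congr_of_eventuallyEq ?_
      filter_upwards [hL.isClosed.isOpen_compl.mem_nhds fun h => hz (hLΩ h)] with y hy
      rw [hχ0 y hy, zero_smul]
  · filter_upwards [hχ1.filter_mono (nhds_le_nhdsSet hz)] with y hy
    rw [hy, one_smul]

section Congr

variable {n : ℕ} {w w' : ℝ^n → ℝ} {x : ℝ^n}

theorem volumeElement_congr (h : w =ᶠ[𝓝 x] w') : volumeElement w x = volumeElement w' x := by
  rw [volumeElement, volumeElement, h.gradient_eq]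

theorem meanCurvature_congr (h : w =ᶠ[𝓝 x] w') : meanCurvature w x = meanCurvature w' x := by
  have hN : conormal w =ᶠ[𝓝 x] conormal w' := by
    filter_upwards [h.eventuallyEq_nhds] with y hy
    rw [conormal, conormal, volumeElement_congr hy, hy.gradient_eq]
  rw [meanCurvature, meanCurvature, divergence, divergence, hN.fderiv_eq]

theorem graphArea_congr {Ω : Set ℝ^n} (hΩ : MeasurableSet Ω) (h : ∀ x ∈ Ω, w =ᶠ[𝓝 x] w') :
    graphArea w Ω = graphArea w' Ω :=
  setLIntegral_congr_fun hΩ fun x hx => by simp only [volumeElement_congr (h x hx)]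

theorem volumeElement_eq_sqrt_fderiv (w : ℝ^n → ℝ) (x : ℝ^n) :
    volumeElement w x = √(1 + ‖fderiv ℝ w x‖ ^ 2) := by
  rw [volumeElement, gradient, LinearIsometryEquiv.norm_map]

theorem measurable_volumeElement (w : ℝ^n → ℝ) : Measurable (volumeElement w) := by
  simp only [funext (volumeElement_eq_sqrt_fderiv w)]
  exact (((measurable_fderiv ℝ w).norm.pow_const 2).const_add 1).sqrt

theorem graphArea_le_weightedArea {φ : ℝ^n → ℝ} (hφ : Continuous φ) (hφc : HasCompactSupport φ)
    (hφ0 : ∀ y, 0 ≤ φ y) (hw : ContDiff ℝ 2 w) {Ω : Set ℝ^n} (hΩ : MeasurableSet Ω) {c : ℝ}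
    (hc : 0 < c) (hcφ : ∀ y ∈ Ω, c ≤ φ y) :
    graphArea w Ω ≤ ENNReal.ofReal (c⁻¹ * weightedArea φ w) := by
  have hint : Integrable fun y => c⁻¹ * (φ y * volumeElement w y) :=
    ((hφ.mul (continuous_volumeElement hw)).integrable_of_hasCompactSupport
      hφc.mul_right).const_mul c⁻¹
  have hnonneg (y : ℝ^n) : 0 ≤ c⁻¹ * (φ y * volumeElement w y) :=
    mul_nonneg (inv_nonneg.2 hc.le) (mul_nonneg (hφ0 y) (volumeElement_pos w y).le)
  rw [weightedArea, ← integral_const_mul,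
    ofReal_integral_eq_lintegral_ofReal hint (ae_of_all _ hnonneg), graphArea]
  refine (setLIntegral_mono' hΩ fun y hy => ENNReal.ofReal_le_ofReal ?_).trans
    (setLIntegral_le_lintegral Ω _)
  rw [← mul_assoc, inv_mul_eq_div]
  exact le_mul_of_one_le_left (volumeElement_pos w y).le ((one_le_div hc).2 (hcφ y hy))

end Congr

theorem eventuallyEq_slice {E F : Type*} [TopologicalSpace E] {U V : E → ℝ → F} {x : E} {t : ℝ}
    (h : Function.uncurry U =ᶠ[𝓝 (x, t)] Function.uncurry V) : (U · t) =ᶠ[𝓝 x] (V · t) :=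
  (Continuous.tendsto (by fun_prop : Continuous fun y => (y, t)) x).eventually h

namespace GraphFlowsByMeanCurvature

variable {n : ℕ} {u : ℝ^n → ℝ → ℝ} {R T ρ a b : ℝ}

theorem exists_contDiff_extension (hu : GraphFlowsByMeanCurvature u R T) (hρR : ρ < R)
    (ha : 0 < a) (hbT : b < T) :
    ∃ U : ℝ^n → ℝ → ℝ, ContDiff ℝ ∞ (Function.uncurry U) ∧
      ∀ x ∈ Metric.closedBall 0 ρ, ∀ t ∈ Icc a b,
        Function.uncurry U =ᶠ[𝓝 (x, t)] Function.uncurry u := by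
  obtain ⟨g, hg, hgu⟩ := exists_contDiff_eventuallyEq (k := ⊤) (f := Function.uncurry u)
    (Metric.isOpen_ball.prod isOpen_Ioo)
    ((isCompact_closedBall (0 : ℝ^n) ρ).prod (isCompact_Icc (a := a) (b := b)))
    (prod_mono (Metric.closedBall_subset_ball hρR) (Icc_subset_Ioo ha hbT))
    fun z hz => hu.contDiffAt hz.1 hz.2
  exact ⟨Function.curry g, hg, fun x hx t ht => hgu (x, t) ⟨hx, ht⟩⟩

theorem deriv_eq_of_eventuallyEq (hu : GraphFlowsByMeanCurvature u R T) {U : ℝ^n → ℝ → ℝ}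
    {x : ℝ^n} {t : ℝ} (hx : x ∈ Metric.ball 0 R) (ht : t ∈ Ioo 0 T)
    (hUu : Function.uncurry U =ᶠ[𝓝 (x, t)] Function.uncurry u) :
    deriv (U x) t = volumeElement (U · t) x * meanCurvature (U · t) x := by
  have hspace : (U · t) =ᶠ[𝓝 x] (u · t) := eventuallyEq_slice hUu
  have htime : U x =ᶠ[𝓝 t] u x :=
    (Continuous.tendsto (by fun_prop : Continuous fun s => (x, s)) t).eventually hUu
  rw [htime.deriv_eq, (hu.hasDerivAt hx ht).deriv, volumeElement_congr hspace,
    meanCurvature_congr hspace]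

theorem graphArea_le_of_lt (hu : GraphFlowsByMeanCurvature u R T) {M σ : ℝ} (hρ : 0 < ρ)
    (hρR : ρ < R) (hM : 0 ≤ M) (h0 : ∀ x ∈ Metric.ball (0 : ℝ^n) R, |u x 0| ≤ M)
    (ha : 0 < a) (hab : a < b) (hbT : b < T) (hσ : 0 < σ) {Ω : Set ℝ^n} (hΩ : MeasurableSet Ω)
    (hΩσ : ∀ x ∈ Ω, σ ≤ heatCutoff ρ b x) :
    graphArea (u · b) Ω ≤ ENNReal.ofReal ((σ ^ 3)⁻¹ * (ρ ^ 4 * (M + ρ) ^ 2 *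
      volume.real (Metric.closedBall (0 : ℝ^n) ρ) * (14 + 4 * ρ ^ 2 / (b - a)))) := by
  obtain ⟨U, hU, hUu⟩ := hu.exists_contDiff_extension hρR ha hbT
  have hU2 : ContDiff ℝ 2 (Function.uncurry U) := hU.of_le (WithTop.coe_le_coe.2 le_top)
  have hb : b ∈ Icc a b := right_mem_Icc.2 hab.le
  have htT (t : ℝ) (ht : t ∈ Icc a b) : t ∈ Ioo 0 T := Icc_subset_Ioo ha hbT ht
  have hmem (t : ℝ) (ht : t ∈ Icc a b) (x : ℝ^n) (hx : 0 < heatCutoff ρ t x) :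
      x ∈ Metric.closedBall 0 ρ := mem_closedBall_of_heatCutoff_pos hρ.le (htT t ht).1.le hx
  have hflow (t : ℝ) (ht : t ∈ Icc a b) (x : ℝ^n) (hx : 0 < heatCutoff ρ t x) :
      deriv (U x) t = volumeElement (U · t) x * meanCurvature (U · t) x :=
    hu.deriv_eq_of_eventuallyEq (Metric.closedBall_subset_ball hρR (hmem t ht x hx)) (htT t ht)
      (hUu x (hmem t ht x hx) t ht)
  have hbound (t : ℝ) (ht : t ∈ Icc a b) (x : ℝ^n) (hx : 0 < heatCutoff ρ t x) :
      |U x t| ≤ M + ρ := by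
    have hUx : U x t = u x t := (hUu x (hmem t ht x hx) t ht).eq_of_nhds
    rw [hUx]
    exact hu.abs_apply_le hρ hρR h0 (Ioo_subset_Ico_self (htT t ht)) (heatCutoff_pos_iff.1 hx)
  have harea : weightedArea (fun x => heatCutoff ρ b x ^ 3) (U · b) ≤ _ :=
    weightedArea_heatCutoff_le_of_flow hU2 hρ.le ha hab (le_add_of_nonneg_left hM) hflow hbound
  have hslice (x : ℝ^n) (hx : x ∈ Ω) : (u · b) =ᶠ[𝓝 x] (U · b) :=
    (eventuallyEq_slice (hUu x (hmem b hb x (hσ.trans_le (hΩσ x hx))) b hb)).symm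
  have hη : HasCompactSupport fun x : ℝ^n => heatCutoff ρ b x ^ 3 :=
    (hasCompactSupport_heatCutoff hρ.le (htT b hb).1.le).comp_left (g := (· ^ 3)) (by simp)
  rw [graphArea_congr hΩ hslice]
  refine (graphArea_le_weightedArea (contDiff_heatCutoff_pow_slice ρ b 1).continuous hη
    (fun x => pow_nonneg (heatCutoff_nonneg ρ b x) 3) (contDiff_slice hU2 b) hΩ (pow_pos hσ 3)
    fun x hx => pow_le_pow_left₀ hσ.le (hΩσ x hx) 3).trans (ENNReal.ofReal_le_ofReal ?_)
  exact mul_le_mul_of_nonneg_left harea (by positivity)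

theorem continuousOn_volumeElement (hu : GraphFlowsByMeanCurvature u R T) (hT : 0 < T)
    {x : ℝ^n} (hx : x ∈ Metric.ball 0 R) :
    ContinuousOn (fun t => volumeElement (u · t) x) (Icc 0 T) := by
  have hdomain : UniqueDiffOn ℝ (Metric.ball (0 : ℝ^n) R ×ˢ Icc 0 T) :=
    Metric.isOpen_ball.uniqueDiffOn.prod (uniqueDiffOn_Icc hT)
  have hfderiv (t : ℝ) (ht : t ∈ Icc 0 T) : fderiv ℝ (u · t) x =
      (fderivWithin ℝ (Function.uncurry u) (Metric.ball 0 R ×ˢ Icc 0 T) (x, t)).comp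
        (ContinuousLinearMap.inl ℝ ℝ^n ℝ) := by
    have huxt : HasFDerivWithinAt (Function.uncurry u) _ _ (x, t) :=
      (hu.smooth.differentiableOn (by simp) (x, t) ⟨hx, ht⟩).hasFDerivWithinAt
    exact ((huxt.comp (f := fun y => (y, t)) (s := Metric.ball 0 R) x
      (hasFDerivAt_prodMk_left x t).hasFDerivWithinAt fun y hy => ⟨hy, ht⟩).hasFDerivAt
        (Metric.isOpen_ball.mem_nhds hx)).fderiv
  have hcont : ContinuousOn (fun t => fderiv ℝ (u · t) x) (Icc 0 T) :=
    (((hu.smooth.continuousOn_fderivWithin hdomain (by simp)).comp (f := fun t : ℝ => (x, t))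
      (by fun_prop) fun t ht => ⟨hx, ht⟩).clm_comp continuousOn_const).congr hfderiv
  simp only [volumeElement_eq_sqrt_fderiv]
  exact ((hcont.norm.pow 2).const_add 1).sqrt

theorem graphArea_final_le (hu : GraphFlowsByMeanCurvature u R T) (hT : 0 < T) {Ω : Set ℝ^n}
    (hΩ : MeasurableSet Ω) (hΩR : Ω ⊆ Metric.ball 0 R) {c : ENNReal} (haT : a < T)
    (hc : ∀ b ∈ Ioo a T, graphArea (u · b) Ω ≤ c) : graphArea (u · T) Ω ≤ c := by
  obtain ⟨b, -, hb, hbT⟩ := exists_seq_strictMono_tendsto' (max_lt haT hT)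
  have hlim (x : ℝ^n) (hx : x ∈ Ω) :
      Tendsto (fun k => ENNReal.ofReal (volumeElement (u · (b k)) x)) atTop
        (𝓝 (ENNReal.ofReal (volumeElement (u · T) x))) :=
    (ENNReal.continuous_ofReal.tendsto _).comp
      ((hu.continuousOn_volumeElement hT (hΩR hx) T ⟨hT.le, le_rfl⟩).tendsto.comp
        (tendsto_nhdsWithin_iff.2 ⟨hbT, Eventually.of_forall fun k =>
          ⟨((le_max_right a 0).trans_lt (hb k).1).le, (hb k).2.le⟩⟩))
  calc graphArea (u · T) Ω
    _ = ∫⁻ x in Ω, liminf (fun k => ENNReal.ofReal (volumeElement (u · (b k)) x)) atTop :=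
      setLIntegral_congr_fun hΩ fun x hx => (hlim x hx).liminf_eq.symm
    _ ≤ liminf (fun k => graphArea (u · (b k)) Ω) atTop :=
      lintegral_liminf_le fun k => (measurable_volumeElement _).ennreal_ofReal
    _ ≤ c := liminf_le_of_frequently_le' (Frequently.of_forall fun k =>
      hc _ ⟨(le_max_left a 0).trans_lt (hb k).1, (hb k).2⟩)

end GraphFlowsByMeanCurvature

section Scaling

variable {n : ℕ} {r ρ M b : ℝ}

/-- The constant of the area bound in dimension `n`: it is obtained at scale `r = 1` from
`|x| ≤ √(2n + 1)`, `η ≥ 1 / 2` on `B_{1/2}` and an elapsed time of at least `1 / 2`. -/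
noncomputable def areaConstant (n : ℕ) : ℝ :=
  8 * volume.real (Metric.ball (0 : ℝ^n) 1) * √(2 * n + 1) ^ (n + 6) *
    (14 + 8 * √(2 * n + 1) ^ 2)

theorem areaConstant_pos (n : ℕ) : 0 < areaConstant n := by
  have hV : 0 < volume.real (Metric.ball (0 : ℝ^n) 1) :=
    ENNReal.toReal_pos (Metric.measure_ball_pos _ _ one_pos).ne' measure_ball_ne_top
  rw [areaConstant]
  positivity

theorem area_bound_le_areaConstant_mul {s : ℝ} (hr : 0 < r) (hρ : 0 ≤ ρ)
    (hρr : ρ ≤ √(2 * n + 1) * r) (hM : 0 ≤ M) (hs : r ^ 2 / 2 ≤ s) :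
    ((r ^ 2 / 2) ^ 3)⁻¹ * (ρ ^ 4 * (M + ρ) ^ 2 * volume.real (Metric.closedBall (0 : ℝ^n) ρ) *
      (14 + 4 * ρ ^ 2 / s)) ≤ areaConstant n * r ^ n * (1 + r⁻¹ * M) ^ 2 := by
  set c : ℝ := √(2 * n + 1)
  have hc : 1 ≤ c := Real.one_le_sqrt.2 (by linarith [n.cast_nonneg (α := ℝ)])
  have hs0 : 0 ≤ s := le_trans (by positivity) hs
  have hMρ : M + ρ ≤ c * r * (1 + r⁻¹ * M) := by
    have : M ≤ c * M := le_mul_of_one_le_left hM hc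
    calc M + ρ ≤ c * M + c * r := add_le_add this hρr
      _ = c * r * (1 + r⁻¹ * M) := by field_simp; ring
  rw [Measure.addHaar_real_closedBall _ _ hρ, finrank_euclideanSpace_fin, areaConstant]
  set V := volume.real (Metric.ball (0 : ℝ^n) 1)
  calc ((r ^ 2 / 2) ^ 3)⁻¹ * (ρ ^ 4 * (M + ρ) ^ 2 * (ρ ^ n * V) * (14 + 4 * ρ ^ 2 / s))
    _ ≤ ((r ^ 2 / 2) ^ 3)⁻¹ * ((c * r) ^ 4 * (c * r * (1 + r⁻¹ * M)) ^ 2 *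
          ((c * r) ^ n * V) * (14 + 4 * (c * r) ^ 2 / (r ^ 2 / 2))) := by gcongr
    _ = 8 * V * c ^ (n + 6) * (14 + 8 * c ^ 2) * r ^ n * (1 + r⁻¹ * M) ^ 2 := by
      field_simp
      ring

theorem le_heatCutoff_of_mem_ball (hρ : ρ ^ 2 = (2 * n + 1) * r ^ 2 - r ^ 2 / 4)
    (hb : b ≤ r ^ 2) {x : ℝ^n} (hx : x ∈ Metric.ball 0 (r / 2)) :
    r ^ 2 / 2 ≤ heatCutoff ρ b x := by
  have hxr : ‖x‖ ^ 2 ≤ (r / 2) ^ 2 :=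
    pow_le_pow_left₀ (norm_nonneg x) (mem_ball_zero_iff.1 hx).le 2
  have hnb : 2 * n * b ≤ 2 * n * r ^ 2 := by gcongr
  exact le_max_of_le_left (by linarith)

theorem exists_radius_sq_eq (n : ℕ) (hr : 0 < r) :
    ∃ ρ, 0 < ρ ∧ ρ < √(2 * n + 1) * r ∧ ρ ^ 2 = (2 * n + 1) * r ^ 2 - r ^ 2 / 4 := by
  have hr2 : 0 < r ^ 2 := by positivity
  have hpos : 0 < (2 * n + 1) * r ^ 2 - r ^ 2 / 4 := by
    linarith [mul_nonneg n.cast_nonneg hr2.le]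
  refine ⟨√((2 * n + 1) * r ^ 2 - r ^ 2 / 4), Real.sqrt_pos.2 hpos, ?_, Real.sq_sqrt hpos.le⟩
  rw [Real.sqrt_lt' (by positivity), mul_pow, Real.sq_sqrt (by positivity)]
  linarith

end Scaling

theorem abs_le_toReal_supNorm {n : ℕ} {w : ℝ^n → ℝ} {Ω : Set ℝ^n} (hw : supNorm w Ω ≠ ⊤)
    {x : ℝ^n} (hx : x ∈ Ω) : |w x| ≤ (supNorm w Ω).toReal :=
  (ENNReal.ofReal_le_iff_le_toReal hw).1
    (le_iSup₂ (f := fun y (_ : y ∈ Ω) => ENNReal.ofReal |w y|) x hx)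

theorem ofReal_mul_one_add_sq {A k : ℝ} (hA : 0 ≤ A) (hk : 0 ≤ k) {s : ENNReal} (hs : s ≠ ⊤) :
    ENNReal.ofReal A * (1 + ENNReal.ofReal k * s) ^ 2 =
      ENNReal.ofReal (A * (1 + k * s.toReal) ^ 2) := by
  have hks : 0 ≤ k * s.toReal := mul_nonneg hk ENNReal.toReal_nonneg
  rw [ENNReal.ofReal_mul hA, ENNReal.ofReal_pow (by positivity),
    ENNReal.ofReal_add zero_le_one hks, ENNReal.ofReal_one, ENNReal.ofReal_mul hk,
    ENNReal.ofReal_toReal hs]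

theorem ofReal_mul_one_add_top_sq {A k : ℝ} (hA : 0 < A) (hk : 0 < k) :
    ENNReal.ofReal A * (1 + ENNReal.ofReal k * ⊤) ^ 2 = ⊤ := by
  rw [ENNReal.mul_top (ENNReal.ofReal_pos.2 hk).ne', add_top, ENNReal.top_pow two_ne_zero,
    ENNReal.mul_top (ENNReal.ofReal_pos.2 hA).ne']

theorem GraphFlowsByMeanCurvature.graphArea_ball_le {n : ℕ} {r M : ℝ} {u : ℝ^n → ℝ → ℝ}
    (hr : 0 < r) (hu : GraphFlowsByMeanCurvature u (√(2 * n + 1) * r) (r ^ 2)) (hM : 0 ≤ M)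
    (h0 : ∀ x ∈ Metric.ball (0 : ℝ^n) (√(2 * n + 1) * r), |u x 0| ≤ M) :
    graphArea (u · (r ^ 2)) (Metric.ball 0 (r / 2)) ≤
      ENNReal.ofReal (areaConstant n * r ^ n * (1 + r⁻¹ * M) ^ 2) := by
  obtain ⟨ρ, hρ, hρR, hρ2⟩ := exists_radius_sq_eq n hr
  have hr2 : 0 < r ^ 2 := by positivity
  have hball : Metric.ball (0 : ℝ^n) (r / 2) ⊆ Metric.ball 0 (√(2 * n + 1) * r) := by
    have hc : 1 ≤ √(2 * n + 1 : ℝ) := Real.one_le_sqrt.2 (by linarith [n.cast_nonneg (α := ℝ)])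
    exact Metric.ball_subset_ball ((half_le_self hr.le).trans (le_mul_of_one_le_left hr.le hc))
  refine hu.graphArea_final_le hr2 measurableSet_ball hball (a := 3 * r ^ 2 / 4) (by linarith)
    fun b hb => (hu.graphArea_le_of_lt (a := r ^ 2 / 4) (σ := r ^ 2 / 2) hρ hρR hM h0
      (by positivity) (by linarith [hb.1]) hb.2 (by positivity) measurableSet_ball fun x =>
        le_heatCutoff_of_mem_ball hρ2 hb.2.le).trans (ENNReal.ofReal_le_ofReal ?_)
  exact area_bound_le_areaConstant_mul hr hρ.le hρR.le hM (by linarith [hb.1])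

theorem theorem3p1 (n : ℕ) :
    ∃ C : ℝ, 0 < C ∧
      ∀ (r : ℝ) (u : EuclideanSpace ℝ (Fin n) → ℝ → ℝ), 0 < r →
        GraphFlowsByMeanCurvature u (√(2 * n + 1) * r) (r ^ 2) →
          graphArea (fun x => u x (r ^ 2)) (Metric.ball 0 (r / 2)) ≤
            ENNReal.ofReal (C * r ^ n) *
              (1 + ENNReal.ofReal r⁻¹ *
                supNorm (fun x => u x 0) (Metric.ball 0 (√(2 * n + 1) * r))) ^ 2 := by
  refine ⟨areaConstant n, areaConstant_pos n, fun r u hr hu => ?_⟩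
  have hA : 0 < areaConstant n * r ^ n := mul_pos (areaConstant_pos n) (pow_pos hr n)
  by_cases htop : supNorm (u · 0) (Metric.ball 0 (√(2 * n + 1) * r)) = ⊤
  · rw [htop, ofReal_mul_one_add_top_sq hA (inv_pos.2 hr)]
    exact le_top
  · rw [ofReal_mul_one_add_sq hA.le (inv_nonneg.2 hr.le) htop]
    exact hu.graphArea_ball_le hr ENNReal.toReal_nonneg fun x => abs_le_toReal_supNorm htop
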